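/- Let $\Omega\subset\mathbb R^3$ be a bounded open set, $T>0$, $Y=[-\tfrac12,\tfrac12)^3$, and let $\frac32<p<\infty$. Let $\chi_f$ be the $Y$-periodic extension to $\mathbb R^3$ of the indicator function of a measurable set $F\subset Y$ (the inclusion phase), $\chi_m=1-\chi_f$, and put $$\rho(y)=\chi_f(y)\rho_f+\chi_m(y)\rho_m,\qquad \alpha(y,\hat y)=C_f\chi_f(y)\chi_f(\hat y)+C_m\chi_m(y)\chi_m(\hat y)+C_i\big(\chi_f(y)\chi_m(\hat y)+\chi_m(y)\chi_f(\hat y)\big),$$ with constants $\rho_f,\rho_m>0$ and $C_f,C_m,C_i\in\mathbb R$. Let $\lambda,\gamma,\delta>0$, let $H_r(a)$ denote the open ball of radius $r$ centred at $a$, and let $\chi_\Omega$ be the indicator function of $\Omega$. Let $L^p_{\rm per}(Y;C(\overline\Omega)^3)$ be the Banach space of ($Y$-periodic in $y$) $L^p$-functions on $Y$ with values in $C(\overline\Omega)^3$. Let $u_0,v_0\in L^p_{\rm per}(Y;C(\overline\Omega)^3)$, $b\in C([0,T];L^p_{\rm per}(Y;C(\overline\Omega)^3))$, and let $u\in C^2([0,T];L^p_{\rm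 per}(Y;C(\overline\Omega)^3))$ be the solution of the two-scale problem $$\begin{aligned}\rho(y)\partial_t^2u(x,y,t)={}&\int_{H_\gamma(x)\cap\Omega}\lambda\frac{(\hat x-x)\otimes(\hat x-x)}{|\hat x-x|^3}\Big(\int_Yu(\hat x,y',t)\,dy'-u(x,y,t)\Big)d\hat x\\&+\int_{H_\delta(y)}\alpha(y,\hat y)\frac{(\hat y-y)\otimes(\hat y-y)}{|\hat y-y|^3}\big(u(x,\hat y,t)-u(x,y,t)\big)d\hat y+b(x,y,t),\end{aligned}$$ with $u(x,y,0)=u_0(x,y)$ and $\partial_tu(x,y,0)=v_0(x,y)$. For $\varepsilon=\frac1n$, $n=1,2,\dots$, define the forcing term $d^\varepsilon(x,t)=\rho^{-1}\big(\tfrac x\varepsilon\big)\big(d^\varepsilon_{S,1}+d^\varepsilon_{S,2}+d^\varepsilon_L\big)(x,t)$, $x\in\Omega$, where $$\begin{aligned}d^\varepsilon_{S,1}&=\int_{H_\delta(0)}\chi_\Omega(x+\varepsilon z)\,\alpha\big(\tfrac x\varepsilon,\tfrac x\varepsilon+z\big)\frac{z\otimes z}{|z|^3}\big(u(x+\varepsilon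 z,\tfrac x\varepsilon+z,t)-u(x,\tfrac x\varepsilon+z,t)\big)dz,\\ d^\varepsilon_{S,2}&=-\int_{H_\delta(0)}\big(1-\chi_\Omega(x+\varepsilon z)\big)\alpha\big(\tfrac x\varepsilon,\tfrac x\varepsilon+z\big)\frac{z\otimes z}{|z|^3}\big(u(x,\tfrac x\varepsilon+z,t)-u(x,\tfrac x\varepsilon,t)\big)dz,\\ d^\varepsilon_L&=\int_{H_\gamma(0)}\chi_\Omega(x+\xi)\,\lambda\frac{\xi\otimes\xi}{|\xi|^3}\Big(u(x+\xi,\tfrac{x+\xi}\varepsilon,t)-\int_Yu(x+\xi,y',t)\,dy'\Big)d\xi.\end{aligned}$$ Then for every $\varepsilon=\frac1n$ and every $t\in[0,T]$ these integrals converge absolutely for almost every $x\in\Omega$, $d^\varepsilon$ belongs to $C([0,T];L^p(\Omega)^3)$ for every such $\varepsilon$, and $$\sup_{\varepsilon}\ \sup_{t\in[0,T]}\|d^\varepsilon(\cdot,t)\|_{L^p(\Omega)^3}<\infty,\qquad \lim_{\varepsilon\to0}\|d^\varepsilon(\cdot,t)\|_{L^p(\Omega)^3}=0\quad\text{for all }t\in[0,T].$$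 -/

import Mathlib

open MeasureTheory Set Filter
open scoped Topology ENNReal

noncomputable section

namespace Peridynamics

/-- Three-dimensional Euclidean space. -/
abbrev R3 := EuclideanSpace ℝ (Fin 3)

/-- The unit period cube `Y`, centred at the origin. -/
def Y : Set R3 := {y | ∀ i, y i ∈ Ico (-(1 / 2) : ℝ) (1 / 2)}

/-- The representative in `Y` of a point `y` modulo the lattice `ℤ³`. A function on `Y` is extended
`Y`-periodically to the whole space by composing it with `toCell`. -/
def toCell (y : R3) : R3 := WithLp.toLp 2 fun i => y i - (⌊y i + 1 / 2⌋ : ℝ)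

/-- A bounded open set `Ω ⊆ ℝ³` (the body). -/
structure Body where
  carrier : Set R3
  isOpen : IsOpen carrier
  isBounded : Bornology.IsBounded carrier

instance (Ω : Body) : CompactSpace (closure Ω.carrier) :=
  isCompact_iff_compactSpace.mp Ω.isBounded.isCompact_closure

/-- The indicator function `χ_Ω`. -/
def Body.chi (Ω : Body) (x : R3) : ℝ := Ω.carrier.indicator (fun _ => (1 : ℝ)) x

/-- The constitutive data of the two-phase periodic medium: the inclusion phase inside the period
cube, bond strengths, densities, the long-range stiffness, and the two horizons. No relation
between the three bond strengths is needed. -/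
structure Medium where
  /-- the part of the period cube occupied by the inclusion phase -/
  inclusion : Set R3
  inclusion_subset : inclusion ⊆ Y
  measurableSet_inclusion : MeasurableSet inclusion
  /-- bond strength inside the inclusion phase -/
  Cf : ℝ
  /-- bond strength inside the matrix phase -/
  Cm : ℝ
  /-- bond strength across an interface -/
  Ci : ℝ
  /-- density of the inclusion phase -/
  rhof : ℝ
  /-- density of the matrix phase -/
  rhom : ℝ
  /-- stiffness of the long-range force -/
  lam : ℝ
  /-- horizon of the long-range force -/
  gam : ℝ
  /-- horizon of the short-range force, in the fast variable -/
  del : ℝ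
  rhof_pos : 0 < rhof
  rhom_pos : 0 < rhom
  lam_pos : 0 < lam
  gam_pos : 0 < gam
  del_pos : 0 < del

namespace Medium

variable (M : Medium)

/-- The periodically extended indicator function of the inclusion phase. -/
def chif (y : R3) : ℝ := M.inclusion.indicator (fun _ => (1 : ℝ)) (toCell y)

/-- The periodically extended indicator function of the matrix phase. -/
def chim (y : R3) : ℝ := 1 - M.chif y

/-- The periodic density `ρ(y)`. -/
def rho (y : R3) : ℝ := M.chif y * M.rhof + M.chim y * M.rhom

/-- The bond strength `α(y, ŷ)` (without the cut-off at the horizon). -/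
def alpha (y y' : R3) : ℝ :=
  M.Cf * (M.chif y * M.chif y') + M.Cm * (M.chim y * M.chim y')
    + M.Ci * (M.chif y * M.chim y' + M.chim y * M.chif y')

end Medium

/-- The kernel `(ξ ⊗ ξ) / |ξ|³` applied to the vector `v`. -/
def bond (ξ v : R3) : R3 := (inner ℝ ξ v / ‖ξ‖ ^ 3) • ξ

/-- The Banach space `L^p_per(Y; C(Ω̄)³)`; its elements are given by their restrictions to the
period cube, and `eval` below is the periodic extension. -/
abbrev LpPer (Ω : Body) (p : ℝ≥0∞) :=
  Lp C(closure Ω.carrier, R3) p ((volume : Measure R3).restrict Y)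

open Classical in
/-- The value `w(x, y)` of an element of `L^p_per(Y; C(Ω̄)³)`, extended `Y`-periodically in `y` and
by zero to `x` outside `Ω̄`. -/
def LpPer.eval {Ω : Body} {p : ℝ≥0∞} (w : LpPer Ω p) (x y : R3) : R3 :=
  if h : x ∈ closure Ω.carrier then w (toCell y) ⟨x, h⟩ else 0

section TwoScale

variable (M : Medium) (Ω : Body)

/-- The long-range two-scale operator `B_L`. -/
def BL (w : R3 → R3 → R3) (x y : R3) : R3 :=
  ∫ x' in Metric.ball x M.gam ∩ Ω.carrier,
    M.lam • bond (x' - x) ((∫ y' in Y, w x' y') - w x y)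

/-- The short-range two-scale operator `B_S`. -/
def BS (w : R3 → R3 → R3) (x y : R3) : R3 :=
  ∫ y' in Metric.ball y M.del, M.alpha y y' • bond (y' - y) (w x y' - w x y)

/-- `u` belongs to `C²([0,T]; L^p_per(Y; C(Ω̄)³))` and solves the two-scale peridynamic
initial-value problem `ρ ∂ₜ²u = B_L u + B_S u + b`, `u(0) = u₀`, `∂ₜu(0) = v₀`. -/
structure IsTwoScaleSolution {p : ℝ≥0∞} [Fact (1 ≤ p)] (T : ℝ) (u₀ v₀ : LpPer Ω p)
    (b u : ℝ → LpPer Ω p) : Prop where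
  contDiffOn : ContDiffOn ℝ 2 u (Icc 0 T)
  equation : ∀ t ∈ Icc 0 T, ∀ᵐ y ∂((volume : Measure R3).restrict Y), ∀ x ∈ Ω.carrier,
    M.rho y • LpPer.eval (iteratedDerivWithin 2 u (Icc 0 T) t) x y
      = BL M Ω (LpPer.eval (u t)) x y + BS M (LpPer.eval (u t)) x y + LpPer.eval (b t) x y
  initial_displacement : u 0 = u₀
  initial_velocity : derivWithin u (Icc 0 T) 0 = v₀

end TwoScale

section Forcing

/-! The forcing term, for a two-scale field `w = w(x, y)` (which will be `u(·, ·, t)`). -/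

variable (M : Medium) (Ω : Body) (w : R3 → R3 → R3) (ε : ℝ) (x : R3)

/-- The integrand of `d_{S,1}^ε(x)`. -/
def integrandS1 (z : R3) : R3 :=
  (Ω.chi (x + ε • z) * M.alpha (ε⁻¹ • x) (ε⁻¹ • x + z)) •
    bond z (w (x + ε • z) (ε⁻¹ • x + z) - w x (ε⁻¹ • x + z))

/-- The integrand of `d_{S,2}^ε(x)` (without the minus sign). -/
def integrandS2 (z : R3) : R3 :=
  ((1 - Ω.chi (x + ε • z)) * M.alpha (ε⁻¹ • x) (ε⁻¹ • x + z)) •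
    bond z (w x (ε⁻¹ • x + z) - w x (ε⁻¹ • x))

/-- The integrand of `d_L^ε(x)`. -/
def integrandL (ξ : R3) : R3 :=
  (Ω.chi (x + ξ) * M.lam) •
    bond ξ (w (x + ξ) (ε⁻¹ • (x + ξ)) - ∫ y' in Y, w (x + ξ) y')

/-- `d_{S,1}^ε(x)` -/
def dS1 : R3 := ∫ z in Metric.ball (0 : R3) M.del, integrandS1 M Ω w ε x z

/-- `d_{S,2}^ε(x)` -/
def dS2 : R3 := -∫ z in Metric.ball (0 : R3) M.del, integrandS2 M Ω w ε x z

/-- `d_L^ε(x)` -/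
def dL : R3 := ∫ ξ in Metric.ball (0 : R3) M.gam, integrandL M Ω w ε x ξ

/-- The forcing term `d^ε(x) = ρ(x/ε)⁻¹ (d_{S,1}^ε + d_{S,2}^ε + d_L^ε)(x)`. -/
def forcing : R3 :=
  (M.rho (ε⁻¹ • x))⁻¹ • (dS1 M Ω w ε x + dS2 M Ω w ε x + dL M Ω w ε x)

/-- The integrals that define `d^ε(x)` converge absolutely. -/
def ForcingConverges : Prop :=
  IntegrableOn (integrandS1 M Ω w ε x) (Metric.ball 0 M.del) ∧
  IntegrableOn (integrandS2 M Ω w ε x) (Metric.ball 0 M.del) ∧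
  IntegrableOn (integrandL M Ω w ε x) (Metric.ball 0 M.gam)

end Forcing

end Peridynamics

end

open Peridynamics

namespace Peridynamics

/-! ### The period cell -/

/-! The forcing is linear in the two-scale field `w`, and the proof is a density argument resting on
a bound uniform in `ε`.

Uniform bound. The kernel is at most `1/|z|`, which is integrable on balls of `ℝ³`. Minkowski's
integral inequality (`eLpNorm_lintegral_le`) therefore reduces each of the three integrals to the
`L^p(Ω)` norm of `x ↦ N(x/ε + z)`, where `N(y)` is the sup norm of `w(·, y)`. Averaging over the
phase in the period cell (`setLIntegral_oscillating_le`) bounds this by a constant times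
`‖N‖_{L^p(Y)}`, uniformly in `ε ≤ 1` and `z`. This is `eLpNorm_forcing_le`; with linearity it makes
the forcing Lipschitz in `w`, so it is continuous in time along `u` and bounded on the compact
interval `[0, T]`.

Convergence. By the uniform bound, the fields whose forcing tends to zero form a closed set, which
is also closed under sums, so fields `1_A(y) g(x)` suffice. For these and `x ∈ Ω`, the integral
`dS1` vanishes in the limit because `g(x + εz) → g(x)`, and `dS2` because `x + εz ∈ Ω` for small
`ε`. In `dL` the factor `1_A - |A ∩ Y|` has mean zero and oscillates rapidly against a fixed
integrable function, so it converges weakly to zero (`tendsto_integral_oscillating`). The forcing of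
such a field is bounded, and dominated convergence gives the `L^p` limit. -/

lemma toCell_apply (y : R3) (i : Fin 3) : toCell y i = y i - (⌊y i + 1 / 2⌋ : ℝ) := rfl

lemma toCell_of_mem_Y {y : R3} (hy : y ∈ Y) : toCell y = y := by
  ext i
  have h : ⌊y i + 1 / 2⌋ = 0 := by
    rw [Int.floor_eq_iff]
    have := hy i
    constructor <;> push_cast <;> linarith [this.1, this.2]
  rw [toCell_apply, h]
  simp

lemma toCell_add_of_int {k : R3} (hk : ∀ i, ∃ m : ℤ, (m : ℝ) = k i) (y : R3) :
    toCell (k + y) = toCell y := by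
  ext i
  obtain ⟨m, hm⟩ := hk i
  simp only [toCell_apply, PiLp.add_apply, ← hm]
  rw [add_assoc, Int.floor_intCast_add]
  push_cast
  ring

lemma measurable_toCell : Measurable toCell := by
  unfold toCell
  fun_prop

lemma Y_eq_preimage :
    Y = (WithLp.ofLp : R3 → Fin 3 → ℝ) ⁻¹' (univ.pi fun _ => Ico (-(1 / 2) : ℝ) (1 / 2)) := by
  ext y
  simp [Y]

lemma measurableSet_Y : MeasurableSet Y := by
  rw [Y_eq_preimage]
  exact (MeasurableSet.univ_pi fun _ => measurableSet_Ico).preimage (by fun_prop)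

lemma volume_Y : (volume : Measure R3) Y = 1 := by
  rw [Y_eq_preimage, (PiLp.volume_preserving_ofLp (Fin 3)).measure_preimage
    (MeasurableSet.univ_pi fun _ => measurableSet_Ico).nullMeasurableSet, Real.volume_pi_Ico]
  norm_num

instance : IsProbabilityMeasure ((volume : Measure R3).restrict Y) :=
  ⟨by rw [Measure.restrict_apply_univ, volume_Y]⟩

lemma norm_le_of_mem_Y {s : R3} (hs : s ∈ Y) : ‖s‖ ≤ 1 := by
  rw [EuclideanSpace.norm_eq, Real.sqrt_le_iff, Fin.sum_univ_three]
  refine ⟨zero_le_one, ?_⟩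
  have h : ∀ i, ‖s i‖ ^ 2 ≤ 1 / 4 := fun i => by
    rw [Real.norm_eq_abs, sq_abs]
    nlinarith [(hs i).1, (hs i).2]
  linarith [h 0, h 1, h 2]

/-- The lattice `ℤ³`. -/
abbrev cellLattice : Submodule ℤ R3 :=
  Submodule.span ℤ (range (EuclideanSpace.basisFun (Fin 3) ℝ).toBasis)

instance : VAddInvariantMeasure cellLattice R3 volume :=
  inferInstanceAs (VAddInvariantMeasure cellLattice.toAddSubgroup R3 volume)

lemma toCell_vadd (k : cellLattice) (y : R3) : toCell (k +ᵥ y) = toCell y := by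
  refine toCell_add_of_int (fun i => ?_) y
  have := (Module.Basis.mem_span_iff_repr_mem ℤ _ _).1 k.2 i
  simpa using this

/-- Subtracting `a` and adding `1/2` to each coordinate carries the cell to `[0,1)³`, the standard
fundamental parallelepiped of the lattice. -/
lemma isAddFundamentalDomain_shifted (a : R3) :
    IsAddFundamentalDomain cellLattice {y | y - a ∈ Y} volume := by
  refine IsAddFundamentalDomain.mk'
    (measurableSet_Y.preimage (measurable_id.sub_const a)).nullMeasurableSet fun x => ?_
  have h := ZSpan.exist_unique_vadd_mem_fundamentalDomain
    (EuclideanSpace.basisFun (Fin 3) ℝ).toBasis (x - a + WithLp.toLp 2 fun _ => 1 / 2)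
  convert h using 2 with k
  simp only [mem_ofPred_eq, Y, ZSpan.mem_fundamentalDomain, Submodule.vadd_def, vadd_eq_add, mem_Ico]
  refine forall_congr' fun i => ?_
  simp only [PiLp.add_apply, PiLp.sub_apply, OrthonormalBasis.coe_toBasis_repr_apply,
    EuclideanSpace.basisFun_repr]
  constructor <;> rintro ⟨h1, h2⟩ <;> constructor <;> linarith

/-- The integral of a periodic function over a period cell does not depend on the cell. -/
lemma setLIntegral_toCell_add (F : R3 → ℝ≥0∞) (a : R3) :
    ∫⁻ s in Y, F (toCell (a + s)) = ∫⁻ s in Y, F s := by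
  have hY : ∫⁻ s in Y, F (toCell s) = ∫⁻ s in Y, F s :=
    setLIntegral_congr_fun measurableSet_Y fun s hs => by rw [toCell_of_mem_Y hs]
  have h0 := isAddFundamentalDomain_shifted 0
  simp only [sub_zero, ofPred_mem_eq] at h0
  -- Two fundamental domains of one lattice give an invariant function the same integral.
  have h := (isAddFundamentalDomain_shifted a).setLIntegral_eq h0 (fun y => F (toCell y))
    fun k y => by rw [toCell_vadd]
  rw [← hY, ← h]
  have := (measurePreserving_add_left (volume : Measure R3) a).setLIntegral_comp_preimage_emb
    (measurableEmbedding_addLeft a) (fun y => F (toCell y)) {y | y - a ∈ Y}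
  rw [← this]
  congr 2
  ext s
  simp

/-- The same invariance as an identity of measures, so that it also applies to signed integrands. -/
lemma measurePreserving_toCell_add (a : R3) :
    MeasurePreserving (fun s => toCell (a + s)) ((volume : Measure R3).restrict Y)
      ((volume : Measure R3).restrict Y) := by
  have hm : Measurable fun s => toCell (a + s) := measurable_toCell.comp (measurable_const_add a)
  refine ⟨hm, Measure.ext_of_lintegral _ fun F hF => ?_⟩
  rw [lintegral_map hF hm, setLIntegral_toCell_add]

/-! ### Periodic oscillations and weakly singular integrals -/

/-- Rapidly oscillating periodic functions are controlled by their mean over the period cell,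
uniformly in the scale and the phase. -/
lemma setLIntegral_oscillating_le {S : Set R3} (hS : MeasurableSet S) {F : R3 → ℝ≥0∞}
    (hF : Measurable F) {ε : ℝ} (hε : 0 < ε) (hε1 : ε ≤ 1) (z : R3) :
    ∫⁻ x in S, F (toCell (ε⁻¹ • x + z))
      ≤ volume (Metric.cthickening 1 S) * ∫⁻ y in Y, F y := by
  set S' := Metric.cthickening 1 S
  have hS' : MeasurableSet S' := Metric.isClosed_cthickening.measurableSet
  -- Translating `x` by `ε • s` changes the phase by `s` and moves points by at most `ε‖s‖ ≤ 1`,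
  -- hence the thickening. Averaging over `s ∈ Y` and applying Tonelli then replaces the oscillating
  -- function by its mean.
  have hshift : ∀ s ∈ Y, ∫⁻ x in S, F (toCell (ε⁻¹ • x + z))
      ≤ ∫⁻ x in S', F (toCell (ε⁻¹ • x + z + s)) := by
    intro s hs
    rw [← lintegral_indicator hS, ← lintegral_indicator hS',
      ← lintegral_add_right_eq_self _ (ε • s)]
    refine lintegral_mono fun x => ?_
    by_cases hx : x + ε • s ∈ S
    · have hx' : x ∈ S' := by
        refine Metric.mem_cthickening_of_dist_le x (x + ε • s) 1 S hx ?_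
        rw [dist_self_add_right, norm_smul, Real.norm_of_nonneg hε.le]
        exact mul_le_one₀ hε1 (norm_nonneg s) (norm_le_of_mem_Y hs)
      rw [indicator_of_mem hx, indicator_of_mem hx', smul_add, inv_smul_smul₀ hε.ne']
      exact le_of_eq (by congr 2; abel)
    · rw [indicator_of_notMem hx]
      exact zero_le
  calc ∫⁻ x in S, F (toCell (ε⁻¹ • x + z))
      = ∫⁻ _ in Y, ∫⁻ x in S, F (toCell (ε⁻¹ • x + z)) := by
        rw [lintegral_const, measure_univ, mul_one]
    _ ≤ ∫⁻ s in Y, ∫⁻ x in S', F (toCell (ε⁻¹ • x + z + s)) :=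
        setLIntegral_mono' measurableSet_Y hshift
    _ = ∫⁻ x in S', ∫⁻ s in Y, F (toCell (ε⁻¹ • x + z + s)) := by
        refine lintegral_lintegral_swap (Measurable.aemeasurable ?_)
        exact hF.comp (measurable_toCell.comp (by fun_prop))
    _ = _ := by
        simp_rw [setLIntegral_toCell_add F]
        rw [lintegral_const, Measure.restrict_apply_univ, mul_comm]

/-- Minkowski's integral inequality against a finite measure, with a uniform bound. -/
lemma eLpNorm_lintegral_le {X Z : Type*} [MeasurableSpace X] [MeasurableSpace Z] {ν : Measure X}
    [SFinite ν] {μ : Measure Z} [IsFiniteMeasure μ] {p : ℝ≥0∞} (hp1 : 1 ≤ p) (hp : p ≠ ∞)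
    {G : X → Z → ℝ≥0∞} (hG : Measurable (Function.uncurry G)) {A : ℝ≥0∞}
    (hA : ∀ z, eLpNorm (fun x => G x z) p ν ≤ A) :
    eLpNorm (fun x => ∫⁻ z, G x z ∂μ) p ν ≤ μ univ * A := by
  have hp0 : p ≠ 0 := (zero_lt_one.trans_le hp1).ne'
  set P := p.toReal
  have hP1 : 1 ≤ P := by simpa using ENNReal.toReal_mono hp hp1
  have hP0 : 0 < P := zero_lt_one.trans_le hP1
  have hA' : ∀ z, ∫⁻ x, G x z ^ P ∂ν ≤ A ^ P := fun z => by
    have := hA z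
    rw [eLpNorm_eq_lintegral_rpow_enorm_toReal hp0 hp] at this
    rw [one_div, ENNReal.rpow_inv_le_iff hP0] at this
    simpa only [enorm_eq_self] using this
  -- Hölder against the constant one. Since `μ` is finite and the bound `A` is uniform in `z`, this
  -- and Tonelli suffice, without duality.
  have hH : ∀ x, (∫⁻ z, G x z ∂μ) ^ P ≤ (∫⁻ z, G x z ^ P ∂μ) * μ univ ^ (P - 1) := fun x => by
    have hx : Measurable (G x) := hG.comp measurable_prodMk_left
    have := eLpNorm'_le_eLpNorm'_mul_rpow_measure_univ (p := 1) (q := P) (μ := μ)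
      zero_lt_one hP1 hx.aestronglyMeasurable
    simp only [eLpNorm'_eq_lintegral_enorm, enorm_eq_self, ENNReal.rpow_one, div_one] at this
    refine (ENNReal.rpow_le_rpow this hP0.le).trans_eq ?_
    rw [ENNReal.mul_rpow_of_nonneg _ _ hP0.le, ← ENNReal.rpow_mul, ← ENNReal.rpow_mul,
      one_div_mul_cancel hP0.ne', ENNReal.rpow_one, sub_mul, one_div_mul_cancel hP0.ne', one_mul]
  rw [eLpNorm_eq_lintegral_rpow_enorm_toReal hp0 hp, one_div, ENNReal.rpow_inv_le_iff hP0]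
  simp only [enorm_eq_self]
  calc ∫⁻ x, (∫⁻ z, G x z ∂μ) ^ P ∂ν
      ≤ ∫⁻ x, (∫⁻ z, G x z ^ P ∂μ) * μ univ ^ (P - 1) ∂ν := lintegral_mono hH
    _ = (∫⁻ z, ∫⁻ x, G x z ^ P ∂ν ∂μ) * μ univ ^ (P - 1) := by
        rw [lintegral_mul_const', lintegral_lintegral_swap]
        · exact (hG.pow_const P).aemeasurable
        · exact ENNReal.rpow_ne_top_of_nonneg (by linarith) (measure_ne_top μ _)
    _ ≤ (∫⁻ _, A ^ P ∂μ) * μ univ ^ (P - 1) := by gcongr with z; exact hA' z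
    _ = (μ univ * A) ^ P := by
        rw [lintegral_const, ENNReal.mul_rpow_of_nonneg _ _ hP0.le, mul_assoc, mul_comm]
        congr 1
        conv_lhs => rw [← ENNReal.rpow_one (μ univ)]
        rw [ENNReal.rpow_one, mul_comm]
        conv_rhs => rw [show P = (P - 1) + 1 by ring]
        rw [ENNReal.rpow_add_of_nonneg _ _ (by linarith) zero_le_one, ENNReal.rpow_one]

/-- In polar coordinates the Jacobian `t²` turns `t⁻¹` into `t`. -/
lemma integrableOn_inv_norm_ball (r : ℝ) :
    IntegrableOn (fun z : R3 => ‖z‖⁻¹) (Metric.ball 0 r) := by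
  rw [integrableOn_fun_norm_addHaar volume (f := fun t => t⁻¹)]
  have h : IntegrableOn (fun t : ℝ => t) (Ioo 0 r) :=
    (continuous_id.integrableOn_Icc (a := 0) (b := r)).mono_set Ioo_subset_Icc_self
  refine h.congr_fun (fun t ht => ?_) measurableSet_Ioo
  have : t ≠ 0 := ht.1.ne'
  simp
  field_simp

/-- The measure with density `1/|z|` on the ball of radius `r`. -/
noncomputable def kernelMeasure (r : ℝ) : Measure R3 :=
  ((volume : Measure R3).restrict (Metric.ball 0 r)).withDensity fun z => ENNReal.ofReal ‖z‖⁻¹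

instance (r : ℝ) : IsFiniteMeasure (kernelMeasure r) :=
  isFiniteMeasure_withDensity_ofReal (integrableOn_inv_norm_ball r).2

lemma lintegral_kernelMeasure (r : ℝ) {F : R3 → ℝ≥0∞} (hF : Measurable F) :
    ∫⁻ z, F z ∂kernelMeasure r = ∫⁻ z in Metric.ball 0 r, ENNReal.ofReal ‖z‖⁻¹ * F z := by
  rw [kernelMeasure, lintegral_withDensity_eq_lintegral_mul _ (by fun_prop) hF]
  rfl

/-- Translations act continuously on `L¹`. -/
lemma exists_integral_translate_sub_le {h : R3 → R3} (hh : Integrable h) {η : ℝ} (hη : 0 < η) :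
    ∃ r > 0, ∀ v : R3, ‖v‖ < r → ∫ ξ, ‖h (v + ξ) - h ξ‖ ≤ η := by
  have hm : MemLp h 1 := memLp_one_iff_integrable.2 hh
  have : Fact ((1 : ℝ≥0∞) ≠ ∞) := ⟨ENNReal.one_ne_top⟩
  have hc : Continuous fun v : R3 => DomAddAct.mk v +ᵥ hm.toLp h :=
    (DomAddAct.continuous_mk).vadd continuous_const
  have h0 := hc.tendsto 0
  rw [Metric.tendsto_nhds_nhds] at h0
  obtain ⟨r, hr, H⟩ := h0 η hη
  refine ⟨r, hr, fun v hv => ?_⟩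
  have := (H (by simpa using hv)).le
  rw [DomAddAct.mk_zero, zero_vadd, dist_eq_norm, DomAddAct.mk_vadd_toLp, ← MemLp.toLp_sub,
    Lp.norm_toLp, eLpNorm_one_eq_lintegral_enorm] at this
  rwa [integral_norm_eq_lintegral_enorm]
  exact ((hh.comp_add_left v).sub hh).1

/-- Rapidly oscillating bounded periodic functions of mean zero converge weakly to zero. -/
lemma tendsto_integral_oscillating {h : R3 → R3} (hh : Integrable h) {φ : R3 → ℝ}
    (hφ : Measurable φ) {B : ℝ} (hB : ∀ y, |φ y| ≤ B) (h0 : ∫ y in Y, φ y = 0) (x : R3) :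
    Tendsto (fun ε : ℝ => ∫ ξ, φ (toCell (ε⁻¹ • (x + ξ))) • h ξ) (𝓝[>] 0) (𝓝 0) := by
  have hB0 : 0 ≤ B := (abs_nonneg _).trans (hB 0)
  -- `I` is unchanged when `ξ` is translated by `ε • s`, which adds the phase `s` and translates
  -- `h`. Without the translation of `h`, the average over phases `s ∈ Y` is zero, so `I` is at most
  -- `B` times the `L¹` error of translating `h`.
  have key : ∀ ε : ℝ, 0 < ε → ∀ η : ℝ, (∀ s ∈ Y, ∫ ξ, ‖h (ε • s + ξ) - h ξ‖ ≤ η) →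
      ‖∫ ξ, φ (toCell (ε⁻¹ • (x + ξ))) • h ξ‖ ≤ B * η := by
    intro ε hε η hη
    set I := ∫ ξ, φ (toCell (ε⁻¹ • (x + ξ))) • h ξ
    have hmeas : ∀ s, Measurable fun ξ => φ (toCell (ε⁻¹ • (x + ξ) + s)) := fun s =>
      hφ.comp (measurable_toCell.comp (by fun_prop))
    have hint : ∀ {g : R3 → R3}, Integrable g → ∀ s,
        Integrable fun ξ => φ (toCell (ε⁻¹ • (x + ξ) + s)) • g ξ := fun {g} hg s =>
      hg.bdd_smul B (hmeas s).aestronglyMeasurable (Eventually.of_forall fun ξ => hB _)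
    have hI : ∀ s, I = ∫ ξ, φ (toCell (ε⁻¹ • (x + ξ) + s)) • h (ε • s + ξ) := fun s => by
      refine (integral_add_left_eq_self (μ := volume)
        (fun ξ => φ (toCell (ε⁻¹ • (x + ξ))) • h ξ) (ε • s)).symm.trans ?_
      refine integral_congr_ae (Eventually.of_forall fun ξ => ?_)
      have : ε⁻¹ • (x + (ε • s + ξ)) = ε⁻¹ • (x + ξ) + s := by
        rw [add_left_comm, smul_add, inv_smul_smul₀ hε.ne', add_comm]
      simp only [this]
    have hprod : Integrable (Function.uncurry fun s ξ => φ (toCell (ε⁻¹ • (x + ξ) + s)) • h ξ)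
        (((volume : Measure R3).restrict Y).prod volume) := by
      have hm : Measurable fun q : R3 × R3 => φ (toCell (ε⁻¹ • (x + q.2) + q.1)) :=
        hφ.comp (measurable_toCell.comp (by fun_prop))
      exact (hh.comp_snd _).bdd_smul B hm.aestronglyMeasurable (Eventually.of_forall fun _ => hB _)
    have hJ : ∫ s in Y, ∫ ξ, φ (toCell (ε⁻¹ • (x + ξ) + s)) • h ξ = 0 := by
      rw [integral_integral_swap hprod]
      refine integral_eq_zero_of_ae (Eventually.of_forall fun ξ => ?_)
      simp only [Pi.zero_apply]
      rw [integral_smul_const]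
      have hmp := measurePreserving_toCell_add (ε⁻¹ • (x + ξ))
      have : ∫ s in Y, φ (toCell (ε⁻¹ • (x + ξ) + s)) = ∫ s in Y, φ s := by
        rw [← integral_map hmp.measurable.aemeasurable hφ.aestronglyMeasurable, hmp.map_eq]
      rw [this, h0, zero_smul]
    have hJi : Integrable (fun s => ∫ ξ, φ (toCell (ε⁻¹ • (x + ξ) + s)) • h ξ)
        ((volume : Measure R3).restrict Y) := hprod.integral_prod_left
    have hIJ : I = ∫ s in Y, (I - ∫ ξ, φ (toCell (ε⁻¹ • (x + ξ) + s)) • h ξ) := by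
      rw [integral_sub (integrable_const _) hJi, hJ, sub_zero,
        integral_const, probReal_univ, one_smul]
    rw [hIJ]
    have := norm_setIntegral_le_of_norm_le_const (μ := (volume : Measure R3)) (s := Y)
      (C := B * η) (f := fun s => I - ∫ ξ, φ (toCell (ε⁻¹ • (x + ξ) + s)) • h ξ)
      (by simp [volume_Y]) fun s hs => ?_
    · simpa [Measure.real, volume_Y] using this
    · have hs' := hh.comp_add_left (ε • s)
      rw [hI s, ← integral_sub (hint hs' s) (hint hh s)]
      refine (norm_integral_le_integral_norm _).trans ?_
      refine le_trans ?_ (mul_le_mul_of_nonneg_left (hη s hs) hB0)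
      rw [← integral_const_mul]
      refine integral_mono ((hint hs' s).sub (hint hh s)).norm
        ((hs'.sub hh).norm.const_mul B) fun ξ => ?_
      simp only
      rw [← smul_sub, norm_smul]
      exact mul_le_mul_of_nonneg_right (hB _) (norm_nonneg _)
  rw [Metric.tendsto_nhds]
  intro e he
  -- Dividing by `B + 1` rather than `B` covers `B = 0` and makes the final inequality strict.
  obtain ⟨r, hr, H⟩ := exists_integral_translate_sub_le hh (η := e / (B + 1)) (by positivity)
  filter_upwards [Ioo_mem_nhdsGT hr] with ε hε
  rw [dist_zero_right]
  refine (key ε hε.1 _ fun s hs => H _ ?_).trans_lt ?_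
  · rw [norm_smul, Real.norm_of_nonneg hε.1.le]
    nlinarith [norm_le_of_mem_Y hs, hε.1, hε.2]
  · rw [← mul_div_assoc, div_lt_iff₀ (by positivity)]
    nlinarith

/-! ### Bounds on the forcing term -/

lemma measurable_bond : Measurable (Function.uncurry bond) := by
  unfold Function.uncurry bond
  fun_prop

/-- Cauchy–Schwarz; at `z = 0` both sides vanish by the convention for division by zero. -/
lemma norm_bond_le (z v : R3) : ‖bond z v‖ ≤ ‖z‖⁻¹ * ‖v‖ := by
  rcases eq_or_ne z 0 with rfl | hz
  · simp [bond]
  have hz' : 0 < ‖z‖ := norm_pos_iff.2 hz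
  rw [bond, norm_smul, norm_div, norm_pow, norm_norm, div_mul_eq_mul_div, div_le_iff₀ (by positivity)]
  calc ‖inner ℝ z v‖ * ‖z‖ ≤ ‖z‖ * ‖v‖ * ‖z‖ := by gcongr; exact norm_inner_le_norm z v
    _ = ‖z‖⁻¹ * ‖v‖ * ‖z‖ ^ 3 := by field_simp

lemma enorm_bond_le (z v : R3) : ‖bond z v‖ₑ ≤ ENNReal.ofReal ‖z‖⁻¹ * ‖v‖ₑ := by
  rw [← ofReal_norm, ← ofReal_norm, ← ENNReal.ofReal_mul (by positivity)]
  exact ENNReal.ofReal_le_ofReal (norm_bond_le z v)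

lemma bond_sub (z v v' : R3) : bond z (v - v') = bond z v - bond z v' := by
  simp only [bond, inner_sub_right, sub_div, sub_smul]

lemma bond_smul (z : R3) (c : ℝ) (v : R3) : bond z (c • v) = c • bond z v := by
  simp only [bond, inner_smul_right, mul_div_assoc, mul_smul]

lemma Body.chi_mem (Ω : Body) (x : R3) : Ω.chi x = 0 ∨ Ω.chi x = 1 := by
  by_cases h : x ∈ Ω.carrier <;> simp [Body.chi, h]

lemma Body.chi_of_mem {Ω : Body} {x : R3} (h : x ∈ Ω.carrier) : Ω.chi x = 1 := by
  simp [Body.chi, h]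

lemma Body.measurable_chi (Ω : Body) : Measurable Ω.chi :=
  measurable_const.indicator Ω.isOpen.measurableSet

lemma Medium.chif_mem (M : Medium) (y : R3) : M.chif y = 0 ∨ M.chif y = 1 := by
  by_cases h : toCell y ∈ M.inclusion <;> simp [Medium.chif, h]

lemma Medium.measurable_chif (M : Medium) : Measurable M.chif :=
  (measurable_const.indicator M.measurableSet_inclusion).comp measurable_toCell

lemma Medium.measurable_rho (M : Medium) : Measurable M.rho := by
  have := M.measurable_chif
  unfold Medium.rho Medium.chim
  fun_prop

lemma Medium.measurable_alpha (M : Medium) : Measurable (Function.uncurry M.alpha) := by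
  have := M.measurable_chif
  unfold Function.uncurry Medium.alpha Medium.chim
  fun_prop

/-- A bound on the bond strength. -/
def Medium.alphaBound (M : Medium) : NNReal := ‖M.Cf‖₊ + ‖M.Cm‖₊ + ‖M.Ci‖₊

/-- The phase indicators are `0` or `1`, so exactly one of the three constants survives. -/
lemma Medium.norm_alpha_le (M : Medium) (y y' : R3) : ‖M.alpha y y'‖ ≤ M.alphaBound := by
  have h1 := abs_nonneg M.Cf
  have h2 := abs_nonneg M.Cm
  have h3 := abs_nonneg M.Ci
  rcases M.chif_mem y with h | h <;> rcases M.chif_mem y' with h' | h' <;>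
    simp [Medium.alpha, Medium.chim, h, h', Medium.alphaBound] <;> linarith

/-- A bound on the inverse of the density. -/
noncomputable def Medium.rhoInvBound (M : Medium) : NNReal := ‖M.rhof⁻¹‖₊ + ‖M.rhom⁻¹‖₊

lemma Medium.norm_rho_inv_le (M : Medium) (y : R3) : ‖(M.rho y)⁻¹‖ ≤ M.rhoInvBound := by
  rcases M.chif_mem y with h | h <;>
    simp [Medium.rho, Medium.chim, h, Medium.rhoInvBound]

/-! ### Weakly singular integrals with kernel `1/|z|` in `L^p` -/

section Kernel

variable {r : ℝ} {J : R3 → R3 → R3} {G : R3 → R3 → ℝ≥0∞}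

lemma measurable_integral_ball (hJ : Measurable (Function.uncurry J)) (r : ℝ) :
    Measurable fun x => ∫ z in Metric.ball 0 r, J x z :=
  hJ.stronglyMeasurable.integral_prod_right.measurable

lemma lintegral_ball_enorm_le (hG : Measurable (Function.uncurry G))
    (h : ∀ x z, ‖J x z‖ₑ ≤ ENNReal.ofReal ‖z‖⁻¹ * G x z) (x : R3) :
    ∫⁻ z in Metric.ball 0 r, ‖J x z‖ₑ ≤ ∫⁻ z, G x z ∂kernelMeasure r := by
  have hx : Measurable (G x) := hG.comp measurable_prodMk_left
  rw [lintegral_kernelMeasure r hx]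
  exact lintegral_mono fun z => h x z

variable {ν : Measure R3} [SFinite ν] {p : ℝ≥0∞} {A : ℝ≥0∞}

lemma eLpNorm_integral_ball_le (hG : Measurable (Function.uncurry G))
    (h : ∀ x z, ‖J x z‖ₑ ≤ ENNReal.ofReal ‖z‖⁻¹ * G x z) (hp1 : 1 ≤ p) (hp : p ≠ ∞)
    (hA : ∀ z, eLpNorm (fun x => G x z) p ν ≤ A) :
    eLpNorm (fun x => ∫ z in Metric.ball 0 r, J x z) p ν ≤ kernelMeasure r univ * A := by
  refine (eLpNorm_mono_enorm fun x => ?_).trans (eLpNorm_lintegral_le hp1 hp hG hA)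
  rw [enorm_eq_self]
  exact (enorm_integral_le_lintegral_enorm _).trans (lintegral_ball_enorm_le hG h x)

/-- Minkowski gives the integral of the majorant a finite `L^p` norm, so it is finite almost
everywhere. -/
lemma ae_integrableOn_ball (hJ : Measurable (Function.uncurry J))
    (hG : Measurable (Function.uncurry G))
    (h : ∀ x z, ‖J x z‖ₑ ≤ ENNReal.ofReal ‖z‖⁻¹ * G x z) (hp1 : 1 ≤ p) (hp : p ≠ ∞)
    (hA : ∀ z, eLpNorm (fun x => G x z) p ν ≤ A) (hA' : A ≠ ∞) :
    ∀ᵐ x ∂ν, IntegrableOn (J x) (Metric.ball 0 r) := by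
  have hp0 : p ≠ 0 := (zero_lt_one.trans_le hp1).ne'
  have hm : Measurable fun x => ∫⁻ z, G x z ∂kernelMeasure r := hG.lintegral_prod_right
  have hfin : eLpNorm (fun x => ∫⁻ z, G x z ∂kernelMeasure r) p ν < ∞ :=
    (eLpNorm_lintegral_le hp1 hp hG hA).trans_lt
      (ENNReal.mul_lt_top (measure_lt_top _ _) hA'.lt_top)
  have hlt := lintegral_rpow_enorm_lt_top_of_eLpNorm_lt_top hp0 hp hfin
  filter_upwards [ae_lt_top (by fun_prop) hlt.ne] with x hx
  refine ⟨(hJ.comp measurable_prodMk_left).aestronglyMeasurable,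
    (lintegral_ball_enorm_le hG h x).trans_lt ?_⟩
  rw [enorm_eq_self] at hx
  exact (ENNReal.rpow_lt_top_iff_of_pos (ENNReal.toReal_pos hp0 hp)).1 hx

end Kernel

/-! ### Measurability and pointwise majorants of the three integrands -/

section Bounds

variable {M : Medium} {Ω : Body} {w : R3 → R3 → R3} {N : R3 → ℝ≥0∞} {ε : ℝ}

lemma measurable_integrandS1 (hw : Measurable (Function.uncurry w)) :
    Measurable (Function.uncurry (integrandS1 M Ω w ε)) := by
  have h1 : Measurable fun q : R3 × R3 => w (q.1 + ε • q.2) (ε⁻¹ • q.1 + q.2) :=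
    hw.comp (f := fun q : R3 × R3 => (q.1 + ε • q.2, ε⁻¹ • q.1 + q.2)) (by fun_prop)
  have h2 : Measurable fun q : R3 × R3 => w q.1 (ε⁻¹ • q.1 + q.2) :=
    hw.comp (f := fun q : R3 × R3 => (q.1, ε⁻¹ • q.1 + q.2)) (by fun_prop)
  have h3 : Measurable fun q : R3 × R3 => M.alpha (ε⁻¹ • q.1) (ε⁻¹ • q.1 + q.2) :=
    M.measurable_alpha.comp (f := fun q : R3 × R3 => (ε⁻¹ • q.1, ε⁻¹ • q.1 + q.2)) (by fun_prop)
  have h4 : Measurable fun q : R3 × R3 => Ω.chi (q.1 + ε • q.2) :=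
    Ω.measurable_chi.comp (by fun_prop)
  have h5 : Measurable fun q : R3 × R3 => bond q.2 (w (q.1 + ε • q.2) (ε⁻¹ • q.1 + q.2) - w q.1 (ε⁻¹ • q.1 + q.2)) :=
    measurable_bond.comp (f := fun q : R3 × R3 => (q.2, w (q.1 + ε • q.2) (ε⁻¹ • q.1 + q.2) - w q.1 (ε⁻¹ • q.1 + q.2))) (by fun_prop)
  have h6 : Measurable fun q : R3 × R3 => Ω.chi (q.1 + ε • q.2) * M.alpha (ε⁻¹ • q.1) (ε⁻¹ • q.1 + q.2) := by fun_prop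
  exact h6.smul h5

lemma measurable_integrandS2 (hw : Measurable (Function.uncurry w)) :
    Measurable (Function.uncurry (integrandS2 M Ω w ε)) := by
  have h1 : Measurable fun q : R3 × R3 => w q.1 (ε⁻¹ • q.1) :=
    hw.comp (f := fun q : R3 × R3 => (q.1, ε⁻¹ • q.1)) (by fun_prop)
  have h2 : Measurable fun q : R3 × R3 => w q.1 (ε⁻¹ • q.1 + q.2) :=
    hw.comp (f := fun q : R3 × R3 => (q.1, ε⁻¹ • q.1 + q.2)) (by fun_prop)
  have h3 : Measurable fun q : R3 × R3 => M.alpha (ε⁻¹ • q.1) (ε⁻¹ • q.1 + q.2) :=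
    M.measurable_alpha.comp (f := fun q : R3 × R3 => (ε⁻¹ • q.1, ε⁻¹ • q.1 + q.2)) (by fun_prop)
  have h4 : Measurable fun q : R3 × R3 => Ω.chi (q.1 + ε • q.2) :=
    Ω.measurable_chi.comp (by fun_prop)
  have h5 : Measurable fun q : R3 × R3 => bond q.2 (w q.1 (ε⁻¹ • q.1 + q.2) - w q.1 (ε⁻¹ • q.1)) :=
    measurable_bond.comp (f := fun q : R3 × R3 => (q.2, w q.1 (ε⁻¹ • q.1 + q.2) - w q.1 (ε⁻¹ • q.1))) (by fun_prop)
  have h6 : Measurable fun q : R3 × R3 => (1 - Ω.chi (q.1 + ε • q.2)) * M.alpha (ε⁻¹ • q.1) (ε⁻¹ • q.1 + q.2) := by fun_prop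
  exact h6.smul h5

lemma measurable_integrandL (hw : Measurable (Function.uncurry w)) :
    Measurable (Function.uncurry (integrandL M Ω w ε)) := by
  have h1 : Measurable fun q : R3 × R3 => w (q.1 + q.2) (ε⁻¹ • (q.1 + q.2)) :=
    hw.comp (f := fun q : R3 × R3 => (q.1 + q.2, ε⁻¹ • (q.1 + q.2))) (by fun_prop)
  have h2 : Measurable fun x => ∫ y' in Y, w x y' :=
    hw.stronglyMeasurable.integral_prod_right.measurable
  have h3 : Measurable fun q : R3 × R3 => ∫ y' in Y, w (q.1 + q.2) y' :=
    h2.comp (measurable_fst.add measurable_snd)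
  have h4 : Measurable fun q : R3 × R3 => Ω.chi (q.1 + q.2) :=
    Ω.measurable_chi.comp (by fun_prop)
  have h5 : Measurable fun q : R3 × R3 => bond q.2 (w (q.1 + q.2) (ε⁻¹ • (q.1 + q.2)) - ∫ y' in Y, w (q.1 + q.2) y') :=
    measurable_bond.comp (f := fun q : R3 × R3 => (q.2, w (q.1 + q.2) (ε⁻¹ • (q.1 + q.2)) - ∫ y' in Y, w (q.1 + q.2) y')) (by fun_prop)
  have h6 : Measurable fun q : R3 × R3 => Ω.chi (q.1 + q.2) * M.lam := by fun_prop
  exact h6.smul h5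

lemma measurable_forcing (hw : Measurable (Function.uncurry w)) :
    Measurable (forcing M Ω w ε) := by
  have h : Measurable fun x : R3 => (M.rho (ε⁻¹ • x))⁻¹ :=
    (M.measurable_rho.comp (measurable_const_smul ε⁻¹)).inv
  exact h.smul (((measurable_integral_ball (measurable_integrandS1 hw) _).add
    (measurable_integral_ball (measurable_integrandS2 hw) _).neg).add
    (measurable_integral_ball (measurable_integrandL hw) _))

lemma enorm_smul_bond_le {c : ℝ} {C : NNReal} (hc : ‖c‖ ≤ C) (z : R3) {v v' : R3} {a b : ℝ≥0∞}
    (hv : ‖v‖ₑ ≤ a) (hv' : ‖v'‖ₑ ≤ b) :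
    ‖c • bond z (v - v')‖ₑ ≤ ENNReal.ofReal ‖z‖⁻¹ * (C * (a + b)) := by
  have hc' : ‖c‖ₑ ≤ C := by
    rw [enorm_eq_nnnorm]
    exact_mod_cast hc
  calc ‖c • bond z (v - v')‖ₑ ≤ C * (ENNReal.ofReal ‖z‖⁻¹ * (a + b)) := by
        rw [enorm_smul]
        gcongr
        refine (enorm_bond_le z _).trans ?_
        gcongr
        exact enorm_sub_le.trans (add_le_add hv hv')
    _ = _ := by ring

/-- `N` majorizes `w` uniformly in the slow variable. Both values of `w` have the same fast
variable, hence the repeated term. -/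
lemma enorm_integrandS1_le (hwN : ∀ x y, ‖w x y‖ₑ ≤ N (toCell y)) (x z : R3) :
    ‖integrandS1 M Ω w ε x z‖ₑ ≤ ENNReal.ofReal ‖z‖⁻¹ *
      (M.alphaBound * (N (toCell (ε⁻¹ • x + z)) + N (toCell (ε⁻¹ • x + z)))) := by
  refine enorm_smul_bond_le ?_ z (hwN _ _) (hwN _ _)
  have := M.norm_alpha_le (ε⁻¹ • x) (ε⁻¹ • x + z)
  rcases Ω.chi_mem (x + ε • z) with h | h <;> simp only [h, zero_mul, one_mul, norm_zero]
  · positivity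
  · exact this

/-- The `+ 0` presents the second term as an oscillating function with phase zero. -/
lemma enorm_integrandS2_le (hwN : ∀ x y, ‖w x y‖ₑ ≤ N (toCell y)) (x z : R3) :
    ‖integrandS2 M Ω w ε x z‖ₑ ≤ ENNReal.ofReal ‖z‖⁻¹ *
      (M.alphaBound * (N (toCell (ε⁻¹ • x + z)) + N (toCell (ε⁻¹ • x + 0)))) := by
  refine enorm_smul_bond_le ?_ z (hwN _ _) (by rw [add_zero]; exact hwN _ _)
  have := M.norm_alpha_le (ε⁻¹ • x) (ε⁻¹ • x + z)
  rcases Ω.chi_mem (x + ε • z) with h | h <;>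
    simp only [h, zero_mul, one_mul, norm_zero, sub_zero, sub_self]
  · exact this
  · positivity

lemma lintegral_enorm_le (hwN : ∀ x y, ‖w x y‖ₑ ≤ N (toCell y)) (x : R3) :
    ∫⁻ y in Y, ‖w x y‖ₑ ≤ ∫⁻ y in Y, N y :=
  setLIntegral_mono' measurableSet_Y fun y hy => by simpa [toCell_of_mem_Y hy] using hwN x y

/-- The displacement `ε⁻¹ • z` is large, but it is only a phase, and the oscillation bound is
uniform in the phase. -/
lemma enorm_integrandL_le (hwN : ∀ x y, ‖w x y‖ₑ ≤ N (toCell y)) (x z : R3) :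
    ‖integrandL M Ω w ε x z‖ₑ ≤ ENNReal.ofReal ‖z‖⁻¹ *
      (‖M.lam‖₊ * (N (toCell (ε⁻¹ • x + ε⁻¹ • z)) + ∫⁻ y in Y, N y)) := by
  refine enorm_smul_bond_le ?_ z (by rw [← smul_add]; exact hwN _ _)
    ((enorm_integral_le_lintegral_enorm _).trans (lintegral_enorm_le hwN _))
  rcases Ω.chi_mem (x + z) with h | h <;> simp [h]

/-- The constant in the bound for rapidly oscillating functions on `Ω`. -/
noncomputable def Body.oscBound (Ω : Body) (p : ℝ≥0∞) : ℝ≥0∞ :=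
  volume (Metric.cthickening 1 Ω.carrier) ^ (1 / p.toReal)

lemma Body.oscBound_ne_top (Ω : Body) (p : ℝ≥0∞) : Ω.oscBound p ≠ ∞ :=
  ENNReal.rpow_ne_top_of_nonneg (by positivity) Ω.isBounded.cthickening.measure_lt_top.ne

variable {p : ℝ≥0∞}

lemma eLpNorm_oscillating_le (hN : Measurable N) (hp1 : 1 ≤ p) (hp : p ≠ ∞) (hε : 0 < ε)
    (hε1 : ε ≤ 1) (z : R3) :
    eLpNorm (fun x => N (toCell (ε⁻¹ • x + z))) p ((volume : Measure R3).restrict Ω.carrier)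
      ≤ Ω.oscBound p * eLpNorm N p ((volume : Measure R3).restrict Y) := by
  have hp0 : p ≠ 0 := (zero_lt_one.trans_le hp1).ne'
  rw [eLpNorm_eq_lintegral_rpow_enorm_toReal hp0 hp, eLpNorm_eq_lintegral_rpow_enorm_toReal hp0 hp,
    Body.oscBound, ← ENNReal.mul_rpow_of_nonneg _ _ (by positivity)]
  exact ENNReal.rpow_le_rpow (setLIntegral_oscillating_le Ω.isOpen.measurableSet
    (F := fun y => ‖N y‖ₑ ^ p.toReal) (by fun_prop) hε hε1 z) (by positivity)

lemma eLpNorm_const_mul_add_le {X : Type*} [MeasurableSpace X] {ν : Measure X} (hp1 : 1 ≤ p)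
    (c : NNReal) {F G : X → ℝ≥0∞} (hF : Measurable F) (hG : Measurable G) {A : ℝ≥0∞}
    (hFA : eLpNorm F p ν ≤ A) (hGA : eLpNorm G p ν ≤ A) :
    eLpNorm (fun x => c * (F x + G x)) p ν ≤ c * (A + A) := by
  refine (eLpNorm_le_nnreal_smul_eLpNorm_of_ae_le_mul' (g := F + G) (c := c)
    (Eventually.of_forall fun x => by simp) p).trans ?_
  rw [ENNReal.smul_def, smul_eq_mul]
  gcongr
  exact (eLpNorm_add_le hF.aestronglyMeasurable hG.aestronglyMeasurable hp1).trans
    (add_le_add hFA hGA)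

lemma lintegral_le_eLpNorm (hN : Measurable N) (hp1 : 1 ≤ p) :
    ∫⁻ y in Y, N y ≤ eLpNorm N p ((volume : Measure R3).restrict Y) := by
  have := eLpNorm_le_eLpNorm_of_exponent_le (μ := (volume : Measure R3).restrict Y) hp1
    hN.aestronglyMeasurable
  simpa [eLpNorm_one_eq_lintegral_enorm] using this

/-- A constant is a periodic function, so the oscillation bound applies; on the probability space
`Y` the mean is at most the `L^p` norm. -/
lemma eLpNorm_cellMean_le (hN : Measurable N) (hp1 : 1 ≤ p) (hp : p ≠ ∞) (hε : 0 < ε)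
    (hε1 : ε ≤ 1) :
    eLpNorm (fun _ : R3 => ∫⁻ y in Y, N y) p ((volume : Measure R3).restrict Ω.carrier)
      ≤ Ω.oscBound p * eLpNorm N p ((volume : Measure R3).restrict Y) := by
  refine (eLpNorm_oscillating_le (N := fun _ => ∫⁻ y in Y, N y) measurable_const hp1 hp hε hε1
    0).trans ?_
  gcongr
  rw [eLpNorm_const _ (zero_lt_one.trans_le hp1).ne' (NeZero.ne _)]
  simpa using lintegral_le_eLpNorm hN hp1

end Bounds

/-! ### The uniform bound, absolute convergence and linearity -/

section ForcingBound

variable {M : Medium} {Ω : Body} {w : R3 → R3 → R3} {N : R3 → ℝ≥0∞} {ε : ℝ} {p : ℝ≥0∞}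

/-- The constant in the bound of the forcing term by the two-scale field. -/
noncomputable def forcingBound (M : Medium) (Ω : Body) (p : ℝ≥0∞) : ℝ≥0∞ :=
  M.rhoInvBound * (2 * (kernelMeasure M.del univ * (M.alphaBound * (2 * Ω.oscBound p)))
    + kernelMeasure M.gam univ * (‖M.lam‖₊ * (2 * Ω.oscBound p)))

lemma forcingBound_ne_top (M : Medium) (Ω : Body) (p : ℝ≥0∞) : forcingBound M Ω p ≠ ∞ := by
  have h := Ω.oscBound_ne_top p
  have h1 := measure_ne_top (kernelMeasure M.del) univ
  have h2 := measure_ne_top (kernelMeasure M.gam) univ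
  unfold forcingBound
  finiteness

lemma measurable_comp_toCell (hN : Measurable N) :
    Measurable fun q : R3 × R3 => N (toCell (ε⁻¹ • q.1 + q.2)) :=
  hN.comp (measurable_toCell.comp (by fun_prop))

lemma measurable_boundS1 (hN : Measurable N) (c : ℝ≥0∞) :
    Measurable (Function.uncurry fun x z : R3 =>
      c * (N (toCell (ε⁻¹ • x + z)) + N (toCell (ε⁻¹ • x + z)))) :=
  ((measurable_comp_toCell hN).add (measurable_comp_toCell hN)).const_mul c

lemma measurable_boundS2 (hN : Measurable N) (c : ℝ≥0∞) :
    Measurable (Function.uncurry fun x z : R3 =>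
      c * (N (toCell (ε⁻¹ • x + z)) + N (toCell (ε⁻¹ • x + 0)))) := by
  have h : Measurable fun q : R3 × R3 => N (toCell (ε⁻¹ • q.1 + 0)) :=
    hN.comp (measurable_toCell.comp (by fun_prop))
  exact ((measurable_comp_toCell hN).add h).const_mul c

lemma measurable_boundL (hN : Measurable N) (c : ℝ≥0∞) :
    Measurable (Function.uncurry fun x z : R3 =>
      c * (N (toCell (ε⁻¹ • x + ε⁻¹ • z)) + ∫⁻ y in Y, N y)) := by
  have h : Measurable fun q : R3 × R3 => N (toCell (ε⁻¹ • q.1 + ε⁻¹ • q.2)) :=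
    hN.comp (measurable_toCell.comp (by fun_prop))
  exact (h.add_const _).const_mul c

lemma measurable_oscillating (hN : Measurable N) (z : R3) :
    Measurable fun x : R3 => N (toCell (ε⁻¹ • x + z)) :=
  hN.comp (measurable_toCell.comp (by fun_prop))

/-- The forcing term is bounded in `L^p(Ω)` by the two-scale field, uniformly in the scale. -/
theorem eLpNorm_forcing_le (hw : Measurable (Function.uncurry w)) (hN : Measurable N)
    (hwN : ∀ x y, ‖w x y‖ₑ ≤ N (toCell y)) (hp1 : 1 ≤ p) (hp : p ≠ ∞) (hε : 0 < ε) (hε1 : ε ≤ 1) :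
    eLpNorm (forcing M Ω w ε) p ((volume : Measure R3).restrict Ω.carrier)
      ≤ forcingBound M Ω p * eLpNorm N p ((volume : Measure R3).restrict Y) := by
  have hosc := eLpNorm_oscillating_le (Ω := Ω) hN hp1 hp hε hε1
  have h1 := eLpNorm_integral_ball_le (r := M.del) (measurable_boundS1 hN _)
    (enorm_integrandS1_le (M := M) (Ω := Ω) (ε := ε) hwN) hp1 hp fun z =>
    eLpNorm_const_mul_add_le hp1 _ (measurable_oscillating hN z) (measurable_oscillating hN z)
      (hosc z) (hosc z)
  have h2 := eLpNorm_integral_ball_le (r := M.del) (measurable_boundS2 hN _)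
    (enorm_integrandS2_le (M := M) (Ω := Ω) (ε := ε) hwN) hp1 hp fun z =>
    eLpNorm_const_mul_add_le hp1 _ (measurable_oscillating hN z) (measurable_oscillating hN 0)
      (hosc z) (hosc 0)
  have h3 := eLpNorm_integral_ball_le (r := M.gam) (measurable_boundL hN _)
    (enorm_integrandL_le (M := M) (Ω := Ω) (ε := ε) hwN) hp1 hp fun z =>
    eLpNorm_const_mul_add_le hp1 _ (measurable_oscillating hN (ε⁻¹ • z)) measurable_const
      (hosc (ε⁻¹ • z)) (eLpNorm_cellMean_le hN hp1 hp hε hε1)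
  have m1 := (measurable_integral_ball
    (measurable_integrandS1 (M := M) (Ω := Ω) (ε := ε) hw) M.del).aestronglyMeasurable
    (μ := (volume : Measure R3).restrict Ω.carrier)
  have m2 := (measurable_integral_ball
    (measurable_integrandS2 (M := M) (Ω := Ω) (ε := ε) hw) M.del).aestronglyMeasurable
    (μ := (volume : Measure R3).restrict Ω.carrier)
  have m3 := (measurable_integral_ball
    (measurable_integrandL (M := M) (Ω := Ω) (ε := ε) hw) M.gam).aestronglyMeasurable
    (μ := (volume : Measure R3).restrict Ω.carrier)
  refine (eLpNorm_le_nnreal_smul_eLpNorm_of_ae_le_mul (c := M.rhoInvBound)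
    (g := dS1 M Ω w ε + dS2 M Ω w ε + dL M Ω w ε) (Eventually.of_forall fun x => ?_) p).trans ?_
  · rw [forcing, nnnorm_smul]
    exact mul_le_mul' (M.norm_rho_inv_le _) le_rfl
  rw [ENNReal.smul_def, smul_eq_mul]
  calc (M.rhoInvBound : ℝ≥0∞) * eLpNorm (dS1 M Ω w ε + dS2 M Ω w ε + dL M Ω w ε) p _
      ≤ M.rhoInvBound * (eLpNorm (dS1 M Ω w ε) p _ + eLpNorm (dS2 M Ω w ε) p _
          + eLpNorm (dL M Ω w ε) p _) := by
        gcongr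
        exact (eLpNorm_add_le (m1.add m2.neg) m3 hp1).trans
          (add_le_add_left (eLpNorm_add_le m1 m2.neg hp1) _)
    _ ≤ _ := mul_le_mul' le_rfl
        (add_le_add (add_le_add h1 ((eLpNorm_neg _ p _).trans_le h2)) h3)
    _ = _ := by
        rw [forcingBound]
        ring

/-- The integrals that define the forcing term converge absolutely almost everywhere. -/
theorem ae_forcingConverges (hw : Measurable (Function.uncurry w)) (hN : Measurable N)
    (hwN : ∀ x y, ‖w x y‖ₑ ≤ N (toCell y)) (hp1 : 1 ≤ p) (hp : p ≠ ∞) (hε : 0 < ε) (hε1 : ε ≤ 1)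
    (hNp : eLpNorm N p ((volume : Measure R3).restrict Y) < ∞) :
    ∀ᵐ x ∂((volume : Measure R3).restrict Ω.carrier), ForcingConverges M Ω w ε x := by
  have hosc := eLpNorm_oscillating_le (Ω := Ω) hN hp1 hp hε hε1
  have hfin : ∀ c : NNReal, (c : ℝ≥0∞) * (Ω.oscBound p * eLpNorm N p (volume.restrict Y)
      + Ω.oscBound p * eLpNorm N p (volume.restrict Y)) ≠ ∞ := fun c => by
    have h := Ω.oscBound_ne_top p
    finiteness
  filter_upwards [ae_integrableOn_ball (r := M.del)
      (measurable_integrandS1 (M := M) (Ω := Ω) (ε := ε) hw)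
      (measurable_boundS1 hN _) (enorm_integrandS1_le hwN) hp1 hp (fun z =>
        eLpNorm_const_mul_add_le hp1 _ (measurable_oscillating hN z) (measurable_oscillating hN z)
          (hosc z) (hosc z)) (hfin _),
    ae_integrableOn_ball (r := M.del) (measurable_integrandS2 (M := M) (Ω := Ω) (ε := ε) hw)
      (measurable_boundS2 hN _) (enorm_integrandS2_le hwN) hp1 hp (fun z =>
        eLpNorm_const_mul_add_le hp1 _ (measurable_oscillating hN z) (measurable_oscillating hN 0)
          (hosc z) (hosc 0)) (hfin _),
    ae_integrableOn_ball (r := M.gam) (measurable_integrandL (M := M) (Ω := Ω) (ε := ε) hw)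
      (measurable_boundL hN _) (enorm_integrandL_le hwN) hp1 hp (fun z =>
        eLpNorm_const_mul_add_le hp1 _ (measurable_oscillating hN (ε⁻¹ • z)) measurable_const
          (hosc (ε⁻¹ • z)) (eLpNorm_cellMean_le hN hp1 hp hε hε1)) (hfin _)] with x h1 h2 h3
  exact ⟨h1, h2, h3⟩

/-- The forcing term depends linearly on the two-scale field. -/
lemma forcing_sub {w' : R3 → R3 → R3} (hw : ∀ x, IntegrableOn (w x) Y)
    (hw' : ∀ x, IntegrableOn (w' x) Y) {x : R3} (h : ForcingConverges M Ω w ε x)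
    (h' : ForcingConverges M Ω w' ε x) :
    forcing M Ω (fun x y => w x y - w' x y) ε x = forcing M Ω w ε x - forcing M Ω w' ε x := by
  -- Splitting each integral is legitimate only where both converge absolutely, so linearity holds
  -- almost everywhere rather than at every point.
  have h1 : dS1 M Ω (fun x y => w x y - w' x y) ε x = dS1 M Ω w ε x - dS1 M Ω w' ε x := by
    rw [dS1, dS1, dS1, ← integral_sub h.1 h'.1]
    congr 1 with z : 1
    rw [integrandS1, integrandS1, integrandS1, ← smul_sub, ← bond_sub, sub_sub_sub_comm]
  have h2 : dS2 M Ω (fun x y => w x y - w' x y) ε x = dS2 M Ω w ε x - dS2 M Ω w' ε x := by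
    rw [dS2, dS2, dS2, ← neg_sub', ← integral_sub h.2.1 h'.2.1]
    congr 2 with z : 1
    rw [integrandS2, integrandS2, integrandS2, ← smul_sub, ← bond_sub, sub_sub_sub_comm]
  have h3 : dL M Ω (fun x y => w x y - w' x y) ε x = dL M Ω w ε x - dL M Ω w' ε x := by
    rw [dL, dL, dL, ← integral_sub h.2.2 h'.2.2]
    congr 1 with z : 1
    rw [integrandL, integrandL, integrandL, ← smul_sub, ← bond_sub, integral_sub (hw _) (hw' _),
      sub_sub_sub_comm]
  rw [forcing, forcing, forcing, h1, h2, h3, ← smul_sub]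
  congr 1
  abel

end ForcingBound

/-! ### Fields with values in `C(Ω̄)³` -/

section Field

variable {M : Medium} {Ω : Body} {ε : ℝ} {p : ℝ≥0∞}

open Classical in
/-- The extension by zero of a continuous function on `Ω̄`. -/
noncomputable def zeroExtend (g : C(closure Ω.carrier, R3)) (x : R3) : R3 :=
  if h : x ∈ closure Ω.carrier then g ⟨x, h⟩ else 0

/-- The two-scale field given by a function of the fast variable with values in `C(Ω̄)³`. -/
noncomputable def field (f : R3 → C(closure Ω.carrier, R3)) (x y : R3) : R3 :=
  zeroExtend (f (toCell y)) x

lemma zeroExtend_sub (g g' : C(closure Ω.carrier, R3)) (x : R3) :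
    zeroExtend (g - g') x = zeroExtend g x - zeroExtend g' x := by
  unfold zeroExtend
  split_ifs <;> simp

lemma norm_zeroExtend_le (g : C(closure Ω.carrier, R3)) (x : R3) : ‖zeroExtend g x‖ ≤ ‖g‖ := by
  unfold zeroExtend
  split_ifs
  · exact g.norm_coe_le_norm _
  · simp

lemma enorm_field_le (f : R3 → C(closure Ω.carrier, R3)) (x y : R3) :
    ‖field f x y‖ₑ ≤ ‖f (toCell y)‖ₑ := by
  simp only [enorm_eq_nnnorm, ENNReal.coe_le_coe]
  exact norm_zeroExtend_le _ _

/-- Evaluation `(g, x) ↦ g x` is jointly continuous on `C(Ω̄) × Ω̄` since `Ω̄` is compact, and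
continuous maps preserve strong measurability. -/
lemma measurable_field {f : R3 → C(closure Ω.carrier, R3)} (hf : StronglyMeasurable f) :
    Measurable (Function.uncurry (field f)) := by
  classical
  have hs : MeasurableSet {q : R3 × R3 | q.1 ∈ closure Ω.carrier} :=
    isClosed_closure.measurableSet.preimage measurable_fst
  have h : StronglyMeasurable fun q : {q : R3 × R3 | q.1 ∈ closure Ω.carrier} =>
      f (toCell q.1.2) ⟨q.1.1, q.2⟩ := by
    have h1 : StronglyMeasurable fun q : {q : R3 × R3 | q.1 ∈ closure Ω.carrier} =>
        f (toCell q.1.2) :=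
      hf.comp_measurable (measurable_toCell.comp (measurable_snd.comp measurable_subtype_coe))
    have h2 : StronglyMeasurable fun q : {q : R3 × R3 | q.1 ∈ closure Ω.carrier} =>
        (⟨q.1.1, q.2⟩ : closure Ω.carrier) :=
      ((measurable_fst.comp measurable_subtype_coe).subtype_mk).stronglyMeasurable
    exact (ContinuousEval.continuous_eval (F := C(closure Ω.carrier, R3))).comp_stronglyMeasurable
      (h1.prodMk h2)
  exact Measurable.dite h.measurable measurable_const hs

lemma integrableOn_field {f : R3 → C(closure Ω.carrier, R3)} (hf : StronglyMeasurable f)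
    (hp1 : 1 ≤ p) (hfp : MemLp f p ((volume : Measure R3).restrict Y)) (x : R3) :
    IntegrableOn (field f x) Y := by
  refine ⟨((measurable_field hf).comp measurable_prodMk_left).aestronglyMeasurable, ?_⟩
  refine (lintegral_enorm_le (N := fun y => ‖f y‖ₑ) (enorm_field_le f) x).trans_lt ?_
  exact (hfp.integrable hp1).2

lemma eLpNorm_forcing_field_le {f : R3 → C(closure Ω.carrier, R3)} (hf : StronglyMeasurable f)
    (hp1 : 1 ≤ p) (hp : p ≠ ∞) (hε : 0 < ε) (hε1 : ε ≤ 1) :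
    eLpNorm (forcing M Ω (field f) ε) p ((volume : Measure R3).restrict Ω.carrier)
      ≤ forcingBound M Ω p * eLpNorm f p ((volume : Measure R3).restrict Y) := by
  refine (eLpNorm_forcing_le (measurable_field hf) hf.enorm (enorm_field_le f) hp1 hp hε
    hε1).trans_eq ?_
  rw [eLpNorm_enorm]

lemma ae_forcingConverges_field {f : R3 → C(closure Ω.carrier, R3)} (hf : StronglyMeasurable f)
    (hfp : MemLp f p ((volume : Measure R3).restrict Y))
    (hp1 : 1 ≤ p) (hp : p ≠ ∞) (hε : 0 < ε) (hε1 : ε ≤ 1) :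
    ∀ᵐ x ∂((volume : Measure R3).restrict Ω.carrier), ForcingConverges M Ω (field f) ε x :=
  ae_forcingConverges (measurable_field hf) hf.enorm (enorm_field_le f) hp1 hp hε hε1
    (by rw [eLpNorm_enorm]; exact hfp.2)

lemma memLp_forcing_field {f : R3 → C(closure Ω.carrier, R3)} (hf : StronglyMeasurable f)
    (hfp : MemLp f p ((volume : Measure R3).restrict Y))
    (hp1 : 1 ≤ p) (hp : p ≠ ∞) (hε : 0 < ε) (hε1 : ε ≤ 1) :
    MemLp (forcing M Ω (field f) ε) p ((volume : Measure R3).restrict Ω.carrier) :=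
  ⟨(measurable_forcing (measurable_field hf)).aestronglyMeasurable,
    (eLpNorm_forcing_field_le hf hp1 hp hε hε1).trans_lt
      (ENNReal.mul_lt_top (forcingBound_ne_top M Ω p).lt_top hfp.2)⟩

lemma forcing_field_sub_ae {f g : R3 → C(closure Ω.carrier, R3)} (hf : StronglyMeasurable f)
    (hfp : MemLp f p ((volume : Measure R3).restrict Y)) (hg : StronglyMeasurable g)
    (hgp : MemLp g p ((volume : Measure R3).restrict Y))
    (hp1 : 1 ≤ p) (hp : p ≠ ∞) (hε : 0 < ε) (hε1 : ε ≤ 1) :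
    forcing M Ω (field (f - g)) ε =ᵐ[(volume : Measure R3).restrict Ω.carrier]
      forcing M Ω (field f) ε - forcing M Ω (field g) ε := by
  filter_upwards [ae_forcingConverges_field (M := M) hf hfp hp1 hp hε hε1,
    ae_forcingConverges_field (M := M) hg hgp hp1 hp hε hε1] with x h1 h2
  rw [Pi.sub_apply, ← forcing_sub (integrableOn_field hf hp1 hfp) (integrableOn_field hg hp1 hgp)
    h1 h2]
  congr 1
  funext x y
  exact zeroExtend_sub _ _ x

/-- The forcing term is a Lipschitz function of the two-scale field. -/
theorem eLpNorm_forcing_field_sub_le {f g : R3 → C(closure Ω.carrier, R3)}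
    (hf : StronglyMeasurable f)
    (hfp : MemLp f p ((volume : Measure R3).restrict Y)) (hg : StronglyMeasurable g)
    (hgp : MemLp g p ((volume : Measure R3).restrict Y))
    (hp1 : 1 ≤ p) (hp : p ≠ ∞) (hε : 0 < ε) (hε1 : ε ≤ 1) :
    eLpNorm (forcing M Ω (field f) ε - forcing M Ω (field g) ε) p
        ((volume : Measure R3).restrict Ω.carrier)
      ≤ forcingBound M Ω p * eLpNorm (f - g) p ((volume : Measure R3).restrict Y) := by
  rw [← eLpNorm_congr_ae (forcing_field_sub_ae hf hfp hg hgp hp1 hp hε hε1)]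
  exact eLpNorm_forcing_field_le (hf.sub hg) hp1 hp hε hε1

end Field

/-! ### Convergence for indicator fields -/

section Limit

variable {M : Medium} {Ω : Body} {p : ℝ≥0∞}

/-- Dominated convergence for the `p`-th powers, with a constant majorant on a finite measure space.
-/
lemma tendsto_eLpNorm_of_bounded {X ι : Type*} [MeasurableSpace X] {ν : Measure X}
    [IsFiniteMeasure ν] {l : Filter ι} [l.IsCountablyGenerated] {F : ι → X → R3}
    (hF : ∀ i, Measurable (F i)) {D : ℝ≥0∞} (hD : D ≠ ∞) (hFD : ∀ i x, ‖F i x‖ₑ ≤ D)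
    (hlim : ∀ᵐ x ∂ν, Tendsto (fun i => F i x) l (𝓝 0)) (hp1 : 1 ≤ p) (hp : p ≠ ∞) :
    Tendsto (fun i => eLpNorm (F i) p ν) l (𝓝 0) := by
  have hp0 : p ≠ 0 := (zero_lt_one.trans_le hp1).ne'
  have hP : 0 < p.toReal := ENNReal.toReal_pos hp0 hp
  simp only [eLpNorm_eq_lintegral_rpow_enorm_toReal hp0 hp]
  have hpow : ∀ {q : ℝ}, 0 < q → Tendsto (fun a : ℝ≥0∞ => a ^ q) (𝓝 0) (𝓝 0) := fun {q} hq => by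
    simpa [hq] using (ENNReal.continuous_rpow_const (y := q)).tendsto 0
  refine (hpow (one_div_pos.2 hP)).comp ?_
  have := tendsto_lintegral_filter_of_dominated_convergence (μ := ν) (l := l)
    (F := fun i x => ‖F i x‖ₑ ^ p.toReal) (f := fun _ => 0) (fun _ => D ^ p.toReal)
    (Eventually.of_forall fun i => (hF i).enorm.pow_const _)
    (Eventually.of_forall fun i => Eventually.of_forall fun x =>
      ENNReal.rpow_le_rpow (hFD i x) hP.le) ?_ ?_
  · simpa using this
  · rw [lintegral_const]
    exact ENNReal.mul_ne_top (ENNReal.rpow_ne_top_of_nonneg hP.le hD) (measure_ne_top _ _)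
  · filter_upwards [hlim] with x hx
    refine (hpow hP).comp ?_
    simpa using hx.enorm

lemma measurable_zeroExtend (g : C(closure Ω.carrier, R3)) : Measurable (zeroExtend g) := by
  classical
  exact Measurable.dite g.continuous.measurable measurable_const isClosed_closure.measurableSet

/-- The extension may jump at the boundary of `Ω`, but `Ω̄` is a neighbourhood of each point of the
open set `Ω`. -/
lemma continuousAt_zeroExtend (g : C(closure Ω.carrier, R3)) {x : R3} (hx : x ∈ Ω.carrier) :
    ContinuousAt (zeroExtend g) x := by
  have h : ContinuousOn (zeroExtend g) (closure Ω.carrier) := by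
    rw [continuousOn_iff_continuous_domRestrict]
    refine g.continuous.congr fun y => ?_
    simp [zeroExtend, y.2]
  exact h.continuousAt (mem_of_superset (Ω.isOpen.mem_nhds hx) subset_closure)

lemma tendsto_add_smul (x z : R3) : Tendsto (fun ε : ℝ => x + ε • z) (𝓝[>] 0) (𝓝 x) := by
  have : Continuous fun ε : ℝ => x + ε • z := by fun_prop
  simpa using (this.tendsto 0).mono_left nhdsWithin_le_nhds

/-- Dominated convergence for weakly singular integrals. -/
lemma tendsto_setIntegral_kernel {r : ℝ} {J : ℝ → R3 → R3} (hJ : ∀ ε, Measurable (J ε))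
    {C : ℝ≥0∞} (hC : C ≠ ∞) (hJC : ∀ ε z, ‖J ε z‖ₑ ≤ ENNReal.ofReal ‖z‖⁻¹ * C)
    (hlim : ∀ z, Tendsto (fun ε => J ε z) (𝓝[>] 0) (𝓝 0)) :
    Tendsto (fun ε => ∫ z in Metric.ball 0 r, J ε z) (𝓝[>] 0) (𝓝 0) := by
  have := tendsto_integral_filter_of_dominated_convergence
    (μ := (volume : Measure R3).restrict (Metric.ball 0 r)) (l := 𝓝[>] (0 : ℝ)) (F := J)
    (f := fun _ => 0) (fun z => ‖z‖⁻¹ * C.toReal)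
    (Eventually.of_forall fun ε => (hJ ε).aestronglyMeasurable)
    (Eventually.of_forall fun ε => Eventually.of_forall fun z => ?_)
    ((integrableOn_inv_norm_ball r).mul_const _) (Eventually.of_forall hlim)
  · simpa using this
  · have h := ENNReal.toReal_mono (ENNReal.mul_ne_top ENNReal.ofReal_ne_top hC) (hJC ε z)
    rwa [toReal_enorm, ENNReal.toReal_mul, ENNReal.toReal_ofReal (by positivity)] at h

variable {A : Set R3} {g : C(closure Ω.carrier, R3)}

/-- The elementary function of the fast variable that equals `g` on `A` and zero elsewhere. -/
noncomputable def stepField (A : Set R3) (g : C(closure Ω.carrier, R3)) :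
    R3 → C(closure Ω.carrier, R3) :=
  A.indicator fun _ => g

lemma stronglyMeasurable_stepField (hA : MeasurableSet A) (g : C(closure Ω.carrier, R3)) :
    StronglyMeasurable (stepField A g) :=
  stronglyMeasurable_const.indicator hA

lemma field_stepField (x y : R3) :
    field (stepField A g) x y = A.indicator (fun _ => (1 : ℝ)) (toCell y) • zeroExtend g x := by
  by_cases h : toCell y ∈ A
  · simp [field, stepField, h]
  · simp [field, stepField, h, zeroExtend]

lemma enorm_field_stepField_le (x y : R3) : ‖field (stepField A g) x y‖ₑ ≤ ‖g‖ₑ :=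
  (enorm_field_le _ x y).trans (enorm_indicator_le_enorm_self (fun _ => g) _)

lemma norm_indicator_one_le (A : Set R3) (y : R3) : |A.indicator (fun _ => (1 : ℝ)) y| ≤ 1 := by
  by_cases h : y ∈ A <;> simp [h]

/-- The fast factor is the same in both terms, leaving `g(x + εz) - g(x)`, which tends to zero for
each `z`. -/
lemma tendsto_dS1_stepField (hA : MeasurableSet A) {x : R3} (hx : x ∈ Ω.carrier) :
    Tendsto (fun ε => dS1 M Ω (field (stepField A g)) ε x) (𝓝[>] 0) (𝓝 0) := by
  have hm : ∀ ε, Measurable (integrandS1 M Ω (field (stepField A g)) ε x) := fun ε =>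
    (measurable_integrandS1 (measurable_field (stronglyMeasurable_stepField hA g))).of_uncurry_left
  refine tendsto_setIntegral_kernel
    (J := fun ε => integrandS1 M Ω (field (stepField A g)) ε x) (C := M.alphaBound * (‖g‖ₑ + ‖g‖ₑ)) hm
    (by finiteness) (fun ε z => enorm_integrandS1_le (N := fun _ => ‖g‖ₑ)
      enorm_field_stepField_le x z) fun z => ?_
  have hg : Tendsto (fun ε : ℝ => M.alphaBound * (‖z‖⁻¹ *
      ‖zeroExtend g (x + ε • z) - zeroExtend g x‖)) (𝓝[>] 0) (𝓝 0) := by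
    have h := ((continuousAt_zeroExtend g hx).tendsto.comp (tendsto_add_smul x z)).sub_const
      (zeroExtend g x)
    simpa using (h.norm.const_mul ‖z‖⁻¹).const_mul (M.alphaBound : ℝ)
  refine squeeze_zero_norm (fun ε => ?_) hg
  rw [integrandS1, field_stepField, field_stepField, ← smul_sub, norm_smul, norm_mul]
  gcongr
  · calc _ ≤ 1 * (M.alphaBound : ℝ) := by
          gcongr
          · rcases Ω.chi_mem (x + ε • z) with h | h <;> simp [h]
          · exact M.norm_alpha_le _ _
      _ = _ := one_mul _
  · refine (norm_bond_le _ _).trans ?_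
    gcongr
    rw [norm_smul]
    exact mul_le_of_le_one_left (norm_nonneg _) (norm_indicator_one_le A _)

/-- For each fixed `z` the integrand is eventually zero, because `x + εz` enters the open set `Ω`.
-/
lemma tendsto_dS2_stepField (hA : MeasurableSet A) {x : R3} (hx : x ∈ Ω.carrier) :
    Tendsto (fun ε => dS2 M Ω (field (stepField A g)) ε x) (𝓝[>] 0) (𝓝 0) := by
  have hm : ∀ ε, Measurable (integrandS2 M Ω (field (stepField A g)) ε x) := fun ε =>
    (measurable_integrandS2 (measurable_field (stronglyMeasurable_stepField hA g))).of_uncurry_left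
  refine (congrArg _ (congrArg _ neg_zero)).mp (tendsto_setIntegral_kernel (r := M.del)
    (J := fun ε => integrandS2 M Ω (field (stepField A g)) ε x) (C := M.alphaBound * (‖g‖ₑ + ‖g‖ₑ)) hm
    (by finiteness) (fun ε z => enorm_integrandS2_le (N := fun _ => ‖g‖ₑ)
      enorm_field_stepField_le x z) fun z => ?_).neg
  refine tendsto_const_nhds.congr' ?_
  filter_upwards [(tendsto_add_smul x z).eventually (Ω.isOpen.mem_nhds hx)] with ε hε
  rw [integrandS2, Body.chi_of_mem hε, sub_self, zero_mul, zero_smul]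

lemma tendsto_dL_stepField (hA : MeasurableSet A) (x : R3) :
    Tendsto (fun ε => dL M Ω (field (stepField A g)) ε x) (𝓝[>] 0) (𝓝 0) := by
  set m : ℝ := ∫ y in Y, A.indicator (fun _ => (1 : ℝ)) y
  have hone : Measurable (A.indicator fun _ => (1 : ℝ)) := measurable_const.indicator hA
  have hint : IntegrableOn (A.indicator fun _ => (1 : ℝ)) Y :=
    (integrable_const (μ := (volume : Measure R3).restrict Y) (1 : ℝ)).indicator hA
  have hmean : ∀ x', ∫ y in Y, field (stepField A g) x' y = m • zeroExtend g x' := fun x' => by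
    simp only [field_stepField]
    rw [integral_smul_const]
    congr 1
    exact setIntegral_congr_fun measurableSet_Y fun y hy => by simp only [toCell_of_mem_Y hy]
  -- The part of the integrand independent of `ε`; the remaining factor is `1_A - m`, evaluated at
  -- the oscillating variable.
  set h : R3 → R3 := (Metric.ball 0 M.gam).indicator fun ξ =>
    (Ω.chi (x + ξ) * M.lam) • bond ξ (zeroExtend g (x + ξ))
  have hmeas : Measurable fun ξ => (Ω.chi (x + ξ) * M.lam) • bond ξ (zeroExtend g (x + ξ)) := by
    have h1 : Measurable fun ξ => zeroExtend g (x + ξ) :=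
      (measurable_zeroExtend g).comp (measurable_const_add x)
    have h2 : Measurable fun ξ => bond ξ (zeroExtend g (x + ξ)) :=
      measurable_bond.comp (f := fun ξ => (ξ, zeroExtend g (x + ξ))) (by fun_prop)
    have h3 : Measurable fun ξ => Ω.chi (x + ξ) * M.lam :=
      (Ω.measurable_chi.comp (measurable_const_add x)).mul_const _
    exact h3.smul h2
  have hh : Integrable h := by
    rw [integrable_indicator_iff measurableSet_ball]
    refine Integrable.mono' ((integrableOn_inv_norm_ball M.gam).mul_const (‖M.lam‖ * ‖g‖))
      hmeas.aestronglyMeasurable (Eventually.of_forall fun ξ => ?_)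
    rw [norm_smul, norm_mul]
    calc _ ≤ 1 * ‖M.lam‖ * (‖ξ‖⁻¹ * ‖g‖) := by
          gcongr
          · rcases Ω.chi_mem (x + ξ) with h | h <;> simp [h]
          · refine (norm_bond_le _ _).trans ?_
            gcongr
            exact norm_zeroExtend_le g _
      _ = _ := by ring
  have hφ0 : ∫ y in Y, (A.indicator (fun _ => (1 : ℝ)) y - m) = 0 := by
    rw [integral_sub hint (integrable_const _), integral_const, probReal_univ, one_smul, sub_self]
  have hφB : ∀ y, |A.indicator (fun _ => (1 : ℝ)) y - m| ≤ 1 + |m| := fun y =>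
    (abs_sub _ _).trans (add_le_add_left (norm_indicator_one_le A y) _)
  refine (tendsto_integral_oscillating hh (hone.sub_const m) hφB hφ0 x).congr fun ε => ?_
  rw [dL, ← integral_indicator measurableSet_ball]
  congr 1 with ξ : 1
  by_cases hξ : ξ ∈ Metric.ball (0 : R3) M.gam
  · simp only [h, indicator_of_mem hξ]
    rw [integrandL, hmean, field_stepField, ← sub_smul, bond_smul, smul_comm]
  · simp only [h, indicator_of_notMem hξ, smul_zero]

lemma tendsto_forcing_stepField (hA : MeasurableSet A) {x : R3} (hx : x ∈ Ω.carrier) :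
    Tendsto (fun ε => forcing M Ω (field (stepField A g)) ε x) (𝓝[>] 0) (𝓝 0) := by
  have h := ((tendsto_dS1_stepField (M := M) (g := g) hA hx).add
    (tendsto_dS2_stepField (M := M) (g := g) hA hx)).add
    (tendsto_dL_stepField (M := M) (Ω := Ω) (g := g) hA x)
  rw [add_zero, add_zero] at h
  have h' := h.norm.const_mul (M.rhoInvBound : ℝ)
  rw [norm_zero, mul_zero] at h'
  refine squeeze_zero_norm (fun ε => ?_) h'
  rw [forcing, norm_smul]
  gcongr
  exact M.norm_rho_inv_le _

/-- The majorant `N` may be taken constant, equal to `‖g‖`, so the bounds are pointwise and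
independent of `ε`. -/
lemma exists_enorm_forcing_stepField_le (M : Medium) (A : Set R3) (g : C(closure Ω.carrier, R3)) :
    ∃ D : ℝ≥0∞, D ≠ ∞ ∧ ∀ ε x, ‖forcing M Ω (field (stepField A g)) ε x‖ₑ ≤ D := by
  have hN : Measurable fun _ : R3 => ‖g‖ₑ := measurable_const
  have hwN := enorm_field_stepField_le (Ω := Ω) (A := A) (g := g)
  have h1 : ∀ ε x, ‖dS1 M Ω (field (stepField A g)) ε x‖ₑ ≤ _ := fun ε x =>
    (enorm_integral_le_lintegral_enorm _).trans (lintegral_ball_enorm_le (r := M.del)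
      (measurable_boundS1 (ε := ε) hN _) (enorm_integrandS1_le (N := fun _ => ‖g‖ₑ) hwN) x)
  have h2 : ∀ ε x, ‖dS2 M Ω (field (stepField A g)) ε x‖ₑ ≤ _ := fun ε x =>
    (enorm_neg _).trans_le <|
    (enorm_integral_le_lintegral_enorm _).trans (lintegral_ball_enorm_le (r := M.del)
      (measurable_boundS2 (ε := ε) hN _) (enorm_integrandS2_le (N := fun _ => ‖g‖ₑ) hwN) x)
  have h3 : ∀ ε x, ‖dL M Ω (field (stepField A g)) ε x‖ₑ ≤ _ := fun ε x =>
    (enorm_integral_le_lintegral_enorm _).trans (lintegral_ball_enorm_le (r := M.gam)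
      (measurable_boundL (ε := ε) hN _) (enorm_integrandL_le (N := fun _ => ‖g‖ₑ) hwN) x)
  simp only [lintegral_const, measure_univ, mul_one] at h1 h2 h3
  have hd := measure_ne_top (kernelMeasure M.del) univ
  have hg := measure_ne_top (kernelMeasure M.gam) univ
  refine ⟨M.rhoInvBound * (M.alphaBound * (‖g‖ₑ + ‖g‖ₑ) * kernelMeasure M.del univ
    + M.alphaBound * (‖g‖ₑ + ‖g‖ₑ) * kernelMeasure M.del univ
    + ‖M.lam‖₊ * (‖g‖ₑ + ‖g‖ₑ) * kernelMeasure M.gam univ), by finiteness, fun ε x => ?_⟩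
  rw [forcing, enorm_smul]
  refine mul_le_mul' ?_ ((enorm_add_le _ _).trans (add_le_add ((enorm_add_le _ _).trans
    (add_le_add (h1 ε x) (h2 ε x))) (h3 ε x)))
  rw [enorm_eq_nnnorm]
  exact_mod_cast M.norm_rho_inv_le _
theorem tendsto_eLpNorm_forcing_stepField (hA : MeasurableSet A) (g : C(closure Ω.carrier, R3))
    (hp1 : 1 ≤ p) (hp : p ≠ ∞) :
    Tendsto (fun ε => eLpNorm (forcing M Ω (field (stepField A g)) ε) p
      ((volume : Measure R3).restrict Ω.carrier)) (𝓝[>] 0) (𝓝 0) := by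
  have : IsFiniteMeasure ((volume : Measure R3).restrict Ω.carrier) :=
    isFiniteMeasure_restrict.2 Ω.isBounded.measure_lt_top.ne
  obtain ⟨D, hD, hFD⟩ := exists_enorm_forcing_stepField_le M A g
  refine tendsto_eLpNorm_of_bounded (fun ε => measurable_forcing (measurable_field
    (stronglyMeasurable_stepField hA g))) hD hFD ?_ hp1 hp
  exact (ae_restrict_mem Ω.isOpen.measurableSet).mono fun x hx => tendsto_forcing_stepField hA hx

end Limit

/-! ### The forcing term as an element of `L^p(Ω)³` -/

section LpForcing

variable {M : Medium} {Ω : Body} {ε : ℝ} {p : ℝ≥0∞}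

lemma eLpNorm_forcing_field_le_add {f g : R3 → C(closure Ω.carrier, R3)}
    (hf : StronglyMeasurable f)
    (hfp : MemLp f p ((volume : Measure R3).restrict Y)) (hg : StronglyMeasurable g)
    (hgp : MemLp g p ((volume : Measure R3).restrict Y))
    (hp1 : 1 ≤ p) (hp : p ≠ ∞) (hε : 0 < ε) (hε1 : ε ≤ 1) :
    eLpNorm (forcing M Ω (field f) ε) p ((volume : Measure R3).restrict Ω.carrier)
      ≤ forcingBound M Ω p * eLpNorm (f - g) p ((volume : Measure R3).restrict Y)
        + eLpNorm (forcing M Ω (field g) ε) p ((volume : Measure R3).restrict Ω.carrier) := by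
  have mf := (memLp_forcing_field (M := M) hf hfp hp1 hp hε hε1).1
  have mg := (memLp_forcing_field (M := M) hg hgp hp1 hp hε hε1).1
  calc _ = eLpNorm (forcing M Ω (field f) ε - forcing M Ω (field g) ε
        + forcing M Ω (field g) ε) p _ := by rw [sub_add_cancel]
    _ ≤ _ := (eLpNorm_add_le (mf.sub mg) mg hp1).trans
      (add_le_add_left (eLpNorm_forcing_field_sub_le hf hfp hg hgp hp1 hp hε hε1) _)

lemma eventually_scale : ∀ᶠ ε : ℝ in 𝓝[>] 0, 0 < ε ∧ ε ≤ 1 := by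
  filter_upwards [Ioo_mem_nhdsGT zero_lt_one] with ε h using ⟨h.1, h.2.le⟩

lemma eLpNorm_sub_eq_zero_of_ae {X E : Type*} [MeasurableSpace X] [NormedAddCommGroup E]
    {ν : Measure X} {f g : X → E} (p : ℝ≥0∞) (hfg : f =ᵐ[ν] g) : eLpNorm (f - g) p ν = 0 := by
  have h0 : f - g =ᵐ[ν] 0 := by
    filter_upwards [hfg] with y hy
    rw [Pi.sub_apply, hy, sub_self, Pi.zero_apply]
  rw [eLpNorm_congr_ae h0, eLpNorm_zero]

/-- The forcing is defined from a representative; the Lipschitz bound shows that its norm depends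
only on the class. -/
lemma eLpNorm_forcing_field_le_of_ae {f g : R3 → C(closure Ω.carrier, R3)}
    (hf : StronglyMeasurable f)
    (hfp : MemLp f p ((volume : Measure R3).restrict Y)) (hg : StronglyMeasurable g)
    (hgp : MemLp g p ((volume : Measure R3).restrict Y))
    (hfg : f =ᵐ[(volume : Measure R3).restrict Y] g)
    (hp1 : 1 ≤ p) (hp : p ≠ ∞) (hε : 0 < ε) (hε1 : ε ≤ 1) :
    eLpNorm (forcing M Ω (field f) ε) p ((volume : Measure R3).restrict Ω.carrier)
      ≤ eLpNorm (forcing M Ω (field g) ε) p ((volume : Measure R3).restrict Ω.carrier) := by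
  have h := eLpNorm_forcing_field_le_add (M := M) hf hfp hg hgp hp1 hp hε hε1
  have hz := eLpNorm_sub_eq_zero_of_ae p hfg
  rwa [hz, mul_zero, zero_add] at h

variable [Fact (1 ≤ p)]

lemma tendsto_eLpNorm_forcing_of_ae_eq_stepField (hp : p ≠ ∞) {w : LpPer Ω p} {s : Set R3}
    (hs : MeasurableSet s) {c : C(closure Ω.carrier, R3)}
    (hw : w =ᵐ[(volume : Measure R3).restrict Y] stepField s c) :
    Tendsto (fun ε => eLpNorm (forcing M Ω (field w) ε) p
      ((volume : Measure R3).restrict Ω.carrier)) (𝓝[>] 0) (𝓝 0) := by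
  refine tendsto_of_tendsto_of_tendsto_of_le_of_le' tendsto_const_nhds
    (tendsto_eLpNorm_forcing_stepField (M := M) hs c Fact.out hp)
    (Eventually.of_forall fun _ => zero_le) ?_
  filter_upwards [eventually_scale] with ε hε
  exact eLpNorm_forcing_field_le_of_ae (Lp.stronglyMeasurable w) (Lp.memLp w)
    (stronglyMeasurable_stepField hs c) ((memLp_congr_ae hw).1 (Lp.memLp w)) hw Fact.out hp
    hε.1 hε.2

lemma eLpNorm_forcing_add_le (hp : p ≠ ∞) (hε : 0 < ε) (hε1 : ε ≤ 1) (F G : LpPer Ω p) :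
    eLpNorm (forcing M Ω (field ⇑(F + G)) ε) p ((volume : Measure R3).restrict Ω.carrier)
      ≤ eLpNorm (forcing M Ω (field F) ε) p ((volume : Measure R3).restrict Ω.carrier)
        + eLpNorm (forcing M Ω (field G) ε) p ((volume : Measure R3).restrict Ω.carrier) := by
  have hp1 : 1 ≤ p := Fact.out
  have hm := fun w : LpPer Ω p => Lp.stronglyMeasurable w
  have hL := fun w : LpPer Ω p => Lp.memLp w
  -- The representative of `F + G` is the sum of representatives only almost everywhere, so the
  -- difference is compared with `F` as a class.
  have h0 : ⇑(F + G) - ⇑G =ᵐ[(volume : Measure R3).restrict Y] F := by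
    filter_upwards [Lp.coeFn_add F G] with y hy
    rw [Pi.sub_apply, hy, Pi.add_apply, add_sub_cancel_right]
  have h1 := eLpNorm_forcing_field_le_of_ae (M := M) ((hm (F + G)).sub (hm G))
    ((hL (F + G)).sub (hL G)) (hm F) (hL F) h0 hp1 hp hε hε1
  rw [eLpNorm_congr_ae (forcing_field_sub_ae (hm (F + G)) (hL (F + G))
    (hm G) (hL G) hp1 hp hε hε1)] at h1
  have mFG := (memLp_forcing_field (M := M) (hm (F + G)) (hL _) hp1 hp hε hε1).1
  have mG := (memLp_forcing_field (M := M) (hm G) (hL _) hp1 hp hε hε1).1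
  calc _ = eLpNorm (forcing M Ω (field ⇑(F + G)) ε - forcing M Ω (field G) ε
        + forcing M Ω (field G) ε) p _ := by rw [sub_add_cancel]
    _ ≤ _ := (eLpNorm_add_le (mFG.sub mG) mG hp1).trans (add_le_add_left h1 _)

lemma isClosed_tendsto_eLpNorm_forcing (hp : p ≠ ∞) :
    IsClosed {w : LpPer Ω p | Tendsto (fun ε => eLpNorm (forcing M Ω (field w) ε) p
      ((volume : Measure R3).restrict Ω.carrier)) (𝓝[>] 0) (𝓝 0)} := by
  refine isClosed_of_closure_subset fun w hw => ?_
  rw [mem_ofPred_eq, ENNReal.tendsto_nhds_zero]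
  intro η hη
  have hC := forcingBound_ne_top M Ω p
  set C := forcingBound M Ω p
  have hη2 : 0 < η / 2 := ENNReal.half_pos hη.ne'
  -- Since `C` does not depend on `ε`, replacing `w` by `w'` costs at most `η / 2` at all small
  -- scales; `C + 1` avoids dividing by zero.
  obtain ⟨w', hw', hd⟩ := EMetric.mem_closure_iff.1 hw (η / 2 / (C + 1))
    (ENNReal.div_pos hη2.ne' (by finiteness))
  rw [mem_ofPred_eq, ENNReal.tendsto_nhds_zero] at hw'
  rw [Lp.edist_def] at hd
  filter_upwards [eventually_scale, hw' _ hη2] with ε hε hε'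
  refine (eLpNorm_forcing_field_le_add (M := M) (Lp.stronglyMeasurable w) (Lp.memLp w)
    (Lp.stronglyMeasurable w') (Lp.memLp w') Fact.out hp hε.1 hε.2).trans ?_
  calc _ ≤ (C + 1) * (η / 2 / (C + 1)) + η / 2 :=
        add_le_add (mul_le_mul' le_self_add hd.le) hε'
    _ ≤ η / 2 + η / 2 := add_le_add_left ENNReal.mul_div_le _
    _ = η := ENNReal.add_halves η

/-- The forcing term tends to zero in `L^p(Ω)` as the scale tends to zero. -/
theorem tendsto_eLpNorm_forcing (hp : p ≠ ∞) (w : LpPer Ω p) :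
    Tendsto (fun ε => eLpNorm (forcing M Ω (field w) ε) p
      ((volume : Measure R3).restrict Ω.carrier)) (𝓝[>] 0) (𝓝 0) := by
  refine Lp.induction hp (fun w : LpPer Ω p => Tendsto (fun ε => eLpNorm
    (forcing M Ω (field w) ε) p ((volume : Measure R3).restrict Ω.carrier)) (𝓝[>] 0) (𝓝 0))
    (fun c s hs hμs => ?_) (fun f g hf hg _ hF hG => ?_)
    (isClosed_tendsto_eLpNorm_forcing hp) w
  · refine tendsto_eLpNorm_forcing_of_ae_eq_stepField hp hs (c := c) ?_
    rw [Lp.simpleFunc.coe_indicatorConst]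
    exact indicatorConstLp_coeFn
  · have hsum := hF.add hG
    rw [add_zero] at hsum
    refine tendsto_of_tendsto_of_tendsto_of_le_of_le' tendsto_const_nhds hsum
      (Eventually.of_forall fun _ => zero_le) ?_
    filter_upwards [eventually_scale] with ε hε
    exact eLpNorm_forcing_add_le hp hε.1 hε.2 _ _

open Classical in
/-- The forcing term as an element of `L^p(Ω)³`. -/
noncomputable def forcingLp (M : Medium) (ε : ℝ) (w : LpPer Ω p) :
    Lp R3 p ((volume : Measure R3).restrict Ω.carrier) :=
  if h : MemLp (forcing M Ω (field w) ε) p ((volume : Measure R3).restrict Ω.carrier) then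
    h.toLp _ else 0

/-- The default value `0` is never taken for `0 < ε ≤ 1` and finite `p`. -/
lemma forcingLp_eq (hp : p ≠ ∞) (hε : 0 < ε) (hε1 : ε ≤ 1) (w : LpPer Ω p) :
    forcingLp M ε w = (memLp_forcing_field (M := M) (Lp.stronglyMeasurable w) (Lp.memLp w)
      Fact.out hp hε hε1).toLp _ :=
  dif_pos _

lemma coeFn_forcingLp (hp : p ≠ ∞) (hε : 0 < ε) (hε1 : ε ≤ 1) (w : LpPer Ω p) :
    forcingLp M ε w =ᵐ[(volume : Measure R3).restrict Ω.carrier] forcing M Ω (field w) ε := by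
  rw [forcingLp_eq hp hε hε1]
  exact MemLp.coeFn_toLp _

lemma norm_forcingLp (hp : p ≠ ∞) (hε : 0 < ε) (hε1 : ε ≤ 1) (w : LpPer Ω p) :
    ‖forcingLp M ε w‖ = (eLpNorm (forcing M Ω (field w) ε) p
      ((volume : Measure R3).restrict Ω.carrier)).toReal := by
  rw [forcingLp_eq hp hε hε1, Lp.norm_toLp]

lemma norm_forcingLp_le (hp : p ≠ ∞) (hε : 0 < ε) (hε1 : ε ≤ 1) (w : LpPer Ω p) :
    ‖forcingLp M ε w‖ ≤ (forcingBound M Ω p).toReal * ‖w‖ := by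
  rw [norm_forcingLp hp hε hε1, Lp.norm_def, ← ENNReal.toReal_mul]
  exact ENNReal.toReal_mono (ENNReal.mul_ne_top (forcingBound_ne_top M Ω p) (Lp.eLpNorm_ne_top w))
    (eLpNorm_forcing_field_le (Lp.stronglyMeasurable w) Fact.out hp hε hε1)

lemma lipschitzWith_forcingLp (hp : p ≠ ∞) (hε : 0 < ε) (hε1 : ε ≤ 1) :
    LipschitzWith (forcingBound M Ω p).toNNReal (forcingLp (Ω := Ω) (p := p) M ε) := by
  intro w w'
  rw [ENNReal.coe_toNNReal (forcingBound_ne_top M Ω p), forcingLp_eq hp hε hε1,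
    forcingLp_eq hp hε hε1, Lp.edist_toLp_toLp, Lp.edist_def]
  exact eLpNorm_forcing_field_sub_le (Lp.stronglyMeasurable w) (Lp.memLp w)
    (Lp.stronglyMeasurable w') (Lp.memLp w') Fact.out hp hε hε1

end LpForcing

lemma one_div_natCast_mem {n : ℕ} (hn : 1 ≤ n) : (0 : ℝ) < 1 / n ∧ (1 / n : ℝ) ≤ 1 := by
  have h : (1 : ℝ) ≤ n := by exact_mod_cast hn
  exact ⟨by positivity, (div_le_one (by positivity)).2 h⟩

end Peridynamics

/-! ### The forcing along the two-scale solution -/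

theorem theorem3p13 (M : Medium) (Ω : Body) (T : ℝ) (hT : 0 < T)
    (p : ℝ≥0∞) [Fact (1 ≤ p)] (hp : 3 / 2 < p) (hp_top : p < ∞)
    (u₀ v₀ : LpPer Ω p) (b : ℝ → LpPer Ω p) (hb : ContinuousOn b (Icc 0 T))
    (u : ℝ → LpPer Ω p) (hu : IsTwoScaleSolution M Ω T u₀ v₀ b u) :
    (∀ n : ℕ, 1 ≤ n → ∀ t ∈ Icc 0 T, ∀ᵐ x ∂((volume : Measure R3).restrict Ω.carrier),
      ForcingConverges M Ω (LpPer.eval (u t)) (1 / n) x) ∧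
    ∃ d : ℕ → ℝ → Lp R3 p ((volume : Measure R3).restrict Ω.carrier),
      (∀ n : ℕ, 1 ≤ n → ∀ t ∈ Icc 0 T, ∀ᵐ x ∂((volume : Measure R3).restrict Ω.carrier),
        d n t x = forcing M Ω (LpPer.eval (u t)) (1 / n) x) ∧
      (∀ n : ℕ, 1 ≤ n → ContinuousOn (d n) (Icc 0 T)) ∧
      (∃ C : ℝ, ∀ n : ℕ, 1 ≤ n → ∀ t ∈ Icc 0 T, ‖d n t‖ ≤ C) ∧
      (∀ t ∈ Icc 0 T, Tendsto (fun n => ‖d n t‖) atTop (𝓝 0)) := by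
  have hp' : p ≠ ∞ := hp_top.ne
  have hp1 : 1 ≤ p := Fact.out
  have hu' : ContinuousOn u (Icc 0 T) := hu.contDiffOn.continuousOn
  refine ⟨fun n hn t _ => ?_, fun n t => forcingLp M (1 / n) (u t), fun n hn t _ => ?_,
    fun n hn => ?_, ?_, fun t _ => ?_⟩
  -- `LpPer.eval (u t)` and `field (u t)` agree by unfolding.
  · exact ae_forcingConverges_field (Lp.stronglyMeasurable _) (Lp.memLp _) hp1 hp'
      (one_div_natCast_mem hn).1 (one_div_natCast_mem hn).2
  · exact coeFn_forcingLp hp' (one_div_natCast_mem hn).1 (one_div_natCast_mem hn).2 (u t)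
  · exact (lipschitzWith_forcingLp hp' (one_div_natCast_mem hn).1
      (one_div_natCast_mem hn).2).continuous.comp_continuousOn hu'
  · obtain ⟨B, hB⟩ := isCompact_Icc.exists_bound_of_continuousOn hu'
    refine ⟨(forcingBound M Ω p).toReal * B, fun n hn t ht => ?_⟩
    exact (norm_forcingLp_le hp' (one_div_natCast_mem hn).1 (one_div_natCast_mem hn).2 _).trans
      (mul_le_mul_of_nonneg_left (hB t ht) ENNReal.toReal_nonneg)
  · have hscale : Tendsto (fun n : ℕ => (1 / n : ℝ)) atTop (𝓝[>] 0) :=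
      tendsto_nhdsWithin_iff.2 ⟨tendsto_one_div_atTop_nhds_zero_nat,
        (eventually_ge_atTop 1).mono fun n hn => (one_div_natCast_mem hn).1⟩
    have h := (ENNReal.tendsto_toReal ENNReal.zero_ne_top).comp
      ((tendsto_eLpNorm_forcing (M := M) hp' (u t)).comp hscale)
    refine h.congr' ?_
    -- The index `n = 0` gives the scale `1 / 0 = 0`, where the norm formula is not available.
    filter_upwards [eventually_ge_atTop 1] with n hn
    exact (norm_forcingLp hp' (one_div_natCast_mem hn).1 (one_div_natCast_mem hn).2 (u t)).symm
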